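/- **Notation.** Let $\mathbb T=\mathbb R/\mathbb Z$. For a finite non-empty set $S$ of natural numbers and a Borel probability measure $\mu$ on $\mathbb T$, let $\nu_S=\frac1{|S|}\sum_{s\in S}\delta_s$, let $\nu*\mu=\sum_{s}\nu(s)\,(T_s)_*\mu$ with $T_s x=sx \pmod 1$, and let $\mu_n=\nu_S^{*n}*\mu$ (so $\mu_0=\mu$ and $\mu_{n}=\nu_S*\mu_{n-1}$). Write $\widehat\mu(a)=\int_{\mathbb T}e^{-2\pi i a x}\,d\mu(x)$ and $$\mathcal F(\mu,\delta)=\{a\in\mathbb Z\setminus\{0\}:|\widehat\mu(a)|>\delta\}.$$ For $A\subset\mathbb R$ and $M>0$ let $\mathcal N(A;M)$ be the minimal number of open balls of radius $M$ (with arbitrary real centers) that cover $A$. A set $S\subset[L,2L]$ of natural numbers is $(\widetilde C,\lambda)$-regular if $|I\cap S|\le\widetilde C\,(|I|/L)^{\lambda}\,|S|$ for every interval $I\subset[L,2L]$ of length $|I|\ge 1$. **Lemma (High dimension to positive density).** For every $\lambda>0$ there exist $\epsilon_0,L_1,C^*,c>0$, depending only on $\lambda$, such that the following holds. Let $L>L_1$,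 $\delta>L^{-C^*}$, $\widetilde C>0$, let $S\subset[L,2L]$ be a non-empty $(\widetilde C,\lambda)$-regular set of natural numbers, let $\mu$ be a Borel probability measure on $\mathbb T$, let $n\ge1$, and let $N,M>0$ be real numbers with $N\le LM$. If $$\mathcal N\bigl(\mathcal F(\mu_n,\delta)\cap[-N,N];\,M\bigr)>\Bigl(\frac NM\Bigr)^{1-\epsilon_0},$$ then there exists $N_1>0$ with $\log\frac{N_1}{M}>\frac12\log\frac NM$ such that $$\mathcal N\bigl(\mathcal F(\mu_{n-1},\delta^4/128)\cap[-LN_1,LN_1];\,LM\bigr)>\frac{c\,\delta^{10}}{\widetilde C}\cdot\frac{N_1}{M}.$$ -/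

import Mathlib

open MeasureTheory
open scoped ENNReal

noncomputable section

/-- The uniform probability measure `ν_S = |S|⁻¹ ∑_{s ∈ S} δ_s` on `ℕ` (used for `S ≠ ∅`). -/
def uniformOn (S : Finset ℕ) : Measure ℕ :=
  (S.card : ℝ≥0∞)⁻¹ • ∑ s ∈ S, Measure.dirac s

/-- The measure `ν * μ = ∑_s ν(s) (T_s)_* μ` on the torus `ℝ/ℤ`, where `T_s x = s x (mod 1)`. -/
def actConv (ν : Measure ℕ) (μ : Measure UnitAddCircle) : Measure UnitAddCircle :=
  Measure.sum fun s : ℕ => ν {s} • μ.map (fun x : UnitAddCircle => s • x)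

/-- The law `μ_n = ν_S^{*n} * μ` of the `n`-th step of the random walk with initial law `μ`:
`μ_0 = μ` and `μ_{n+1} = ν_S * μ_n`. -/
def walkMeasure (S : Finset ℕ) (μ : Measure UnitAddCircle) (n : ℕ) : Measure UnitAddCircle :=
  (actConv (uniformOn S))^[n] μ

/-- The Fourier coefficient `∫ e^{-2π i a x} dμ(x)` of a measure on the torus. -/
def measureFourierCoeff (μ : Measure UnitAddCircle) (a : ℤ) : ℂ :=
  ∫ x, fourier (-a) x ∂μ

/-- `F(μ, δ)`: the nonzero integers at which the Fourier coefficient of `μ` exceeds `δ` in absolute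
value, as a subset of the real line. -/
def largeFourier (μ : Measure UnitAddCircle) (δ : ℝ) : Set ℝ :=
  {x | ∃ a : ℤ, a ≠ 0 ∧ δ < ‖measureFourierCoeff μ a‖ ∧ x = (a : ℝ)}

/-- `N(A; M)`: the least number of open balls of radius `M`, with arbitrary real centres, that
cover `A`. For bounded `A` and `M > 0` such finite covers exist, see `exists_ball_cover`. -/
def ballCoveringNumber (A : Set ℝ) (M : ℝ) : ℕ :=
  sInf {k | ∃ C : Finset ℝ, C.card = k ∧ A ⊆ ⋃ c ∈ C, Metric.ball c M}

theorem exists_ball_cover (A : Set ℝ) (N M : ℝ) (hM : 0 < M) :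
    {k | ∃ C : Finset ℝ, C.card = k ∧
      A ∩ Set.Icc (-N) N ⊆ ⋃ c ∈ C, Metric.ball c M}.Nonempty := by
  obtain ⟨t, -, htf, ht⟩ := (isCompact_Icc (a := -N) (b := N)).finite_cover_balls hM
  refine ⟨_, htf.toFinset, rfl, fun x hx => ?_⟩
  simpa using ht hx.2

/-- `(C, lam)`-regularity at scale `r` of a set `S ⊆ [L, 2L]`:
`|I ∩ S| ≤ C (|I| / L)^lam |S|` for every interval `I ⊆ [L, 2L]` of length `|I| ≥ r`.
(It is enough to consider closed intervals: they contain the other intervals with the same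
end points.) -/
def IsRegularAtScale (L : ℝ) (S : Finset ℕ) (C lam r : ℝ) : Prop :=
  ∀ x y : ℝ, L ≤ x → x ≤ y → y ≤ 2 * L → r ≤ y - x →
    (((S : Set ℕ) ∩ {s | (s : ℝ) ∈ Set.Icc x y}).ncard : ℝ) ≤
      C * ((y - x) / L) ^ lam * (S.card : ℝ)

/-- `(C, lam)`-regularity means `(C, lam)`-regularity at scale `1`. -/
def IsRegularSet (L : ℝ) (S : Finset ℕ) (C lam : ℝ) : Prop :=
  IsRegularAtScale L S C lam 1

end

/-! Put `K = N / M`, `lam' = min lam 1`, `κ = lam' / 4`, `α = 1 - κ`. Choose an `M`-separated set of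
at least `K ^ (1 - κ / 8)` large frequencies of `μ_n`, and in it the part `B` lying in an interval
of length `ρ * M` where (count) / (length)^α is maximal up to a factor 2
(`exists_frostman_interval`). Near-maximality makes `B` Frostman of exponent `α`; separation forces
`ρ ≥ K ^ (2 / 3)` (`density_exponents`).

The coefficient of `μ_n` at `a` is the average over `s ∈ S` of those of `μ_{n-1}` at `s * a`. Two
Cauchy–Schwarz steps give `b ∈ B`, `t ∈ S` such that, for a proportion of order `δ ^ 4` of the
triples `(s, a, a')`, the frequency `s (a - b) - t (a' - b)` is nonzero and large for `μ_{n-1}`. If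
`k` balls of radius `L * M` cover these frequencies, Cauchy–Schwarz over the balls bounds the
squared number of pairs for each `s` by `k` times a number of collisions, i.e. solutions of `|t' (x
- y) - τ (x' - y')| ≤ 2` with `x, y, x', y'` in `X = (B - b) / M`, `t' = s / L` and `τ = t / L`.

On average over `t' ∈ T = S / L` there are `O(Ctilde |X|⁴ / ρ)` collisions
(`sum_card_collisions_le`), as for independent random points. With `f` the exponential sum of `X`,
the count is at most 8 times the integral of `|f(t' v)|² |f(τ v)|²` over `[0, 1]`. Near `v = z / ρ`
the Frostman condition bounds the mean of `|f|²` by `|X|² z ^ (-α)`. As `f` varies only at scale `1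
/ ρ`, regularity of `T` bounds the `t'`-average of `|f(t' v)|²` by `|X|² z ^ (1 - lam' - α)`. A
dyadic shell thus contributes `|X|⁴ z ^ (2 - lam' - 2α) / ρ`, summable since `lam' + 2α > 2`: the
dimension of `B` must be close to 1 in terms of `lam`. Hence `k` is at least a constant times `δ ^ 8
* ρ / Ctilde`. When `δ ^ 10 * K` is bounded, one large frequency suffices. -/

/-! ### Fejér kernel and exponential sums -/

/-- The one-sided Fejér kernel. -/
noncomputable def fejer (u : ℝ) : ℝ := ∫ v in (0 : ℝ)..1, (1 - v) * Real.cos (u * v)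

theorem fejer_eq {u : ℝ} (hu : u ≠ 0) : fejer u = (1 - Real.cos u) / u ^ 2 := by
  have h : ∀ v ∈ Set.uIcc (0 : ℝ) 1, HasDerivAt
      (fun v => (1 - v) * (Real.sin (u * v) / u) - Real.cos (u * v) / u ^ 2)
      ((1 - v) * Real.cos (u * v)) v := by
    intro v _
    have h1 : HasDerivAt (fun v : ℝ => u * v) u v := by
      simpa using (hasDerivAt_id v).const_mul u
    have h2 := (((hasDerivAt_id v).const_sub 1).mul (h1.sin.div_const u)).sub
      (h1.cos.div_const (u ^ 2))
    refine h2.congr_deriv ?_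
    simp only [id]
    field_simp
    ring
  rw [fejer, intervalIntegral.integral_eq_sub_of_hasDerivAt h
    (Continuous.intervalIntegrable (by fun_prop) _ _)]
  simp
  ring

theorem fejer_zero : fejer 0 = 1 / 2 := by
  have : fejer 0 = ∫ v in (0 : ℝ)..1, (1 - v) := by simp [fejer]
  rw [this, intervalIntegral.integral_sub (by simp) (by simp)]
  simp
  norm_num

theorem fejer_nonneg (u : ℝ) : 0 ≤ fejer u := by
  rcases eq_or_ne u 0 with rfl | hu
  · rw [fejer_zero]; norm_num
  · rw [fejer_eq hu]
    have := Real.cos_le_one u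
    exact div_nonneg (by linarith) (sq_nonneg u)

theorem fejer_le_half (u : ℝ) : fejer u ≤ 1 / 2 := by
  rcases eq_or_ne u 0 with rfl | hu
  · rw [fejer_zero]
  · rw [fejer_eq hu, div_le_iff₀ (by positivity)]
    have := Real.one_sub_sq_div_two_le_cos (x := u)
    linarith

theorem fejer_le_two_div_sq {u : ℝ} (hu : u ≠ 0) : fejer u ≤ 2 / u ^ 2 := by
  rw [fejer_eq hu]
  have := Real.neg_one_le_cos u
  gcongr
  linarith

theorem one_eighth_le_fejer {u : ℝ} (hu : |u| ≤ 2) : 1 / 8 ≤ fejer u := by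
  rcases eq_or_ne u 0 with rfl | hu0
  · rw [fejer_zero]; norm_num
  · rw [fejer_eq hu0, le_div_iff₀ (by positivity)]
    have h3 := Real.pi_gt_three
    have h := Real.cos_le_one_sub_mul_cos_sq (x := u) (by linarith)
    have : 1 / 8 ≤ 2 / Real.pi ^ 2 := by
      rw [div_le_div_iff₀ (by norm_num) (by positivity)]
      nlinarith [Real.pi_le_four, Real.pi_pos]
    nlinarith [sq_nonneg u]

/-- The exponential sum with frequencies `X` and real weights `w`. -/
noncomputable def expSum (X : Finset ℝ) (w : ℝ → ℝ) (η : ℝ) : ℂ :=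
  ∑ x ∈ X, (w x : ℂ) * Complex.exp ((x * η : ℝ) * Complex.I)

theorem continuous_expSum (X : Finset ℝ) (w : ℝ → ℝ) : Continuous (expSum X w) := by
  unfold expSum
  fun_prop

theorem norm_expSum_sq (X : Finset ℝ) (w : ℝ → ℝ) (η : ℝ) :
    ‖expSum X w η‖ ^ 2 = ∑ x ∈ X, ∑ y ∈ X, w x * w y * Real.cos ((x - y) * η) := by
  have hre : (expSum X w η).re = ∑ x ∈ X, w x * Real.cos (x * η) := by
    simp only [expSum, Complex.re_sum, Complex.re_ofReal_mul, Complex.exp_ofReal_mul_I_re]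
  have him : (expSum X w η).im = ∑ x ∈ X, w x * Real.sin (x * η) := by
    simp only [expSum, Complex.im_sum, Complex.im_ofReal_mul, Complex.exp_ofReal_mul_I_im]
  rw [← Complex.normSq_eq_norm_sq, Complex.normSq_apply, hre, him, Finset.sum_mul_sum,
    Finset.sum_mul_sum, ← Finset.sum_add_distrib]
  refine Finset.sum_congr rfl fun x _ => ?_
  rw [← Finset.sum_add_distrib]
  refine Finset.sum_congr rfl fun y _ => ?_
  rw [sub_mul, Real.cos_sub]
  ring

theorem norm_expSum_one_le (X : Finset ℝ) (η : ℝ) : ‖expSum X (fun _ => 1) η‖ ≤ X.card := by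
  refine (norm_sum_le _ _).trans ?_
  simp only [Complex.ofReal_one, one_mul, Complex.norm_exp_ofReal_mul_I]
  simp

/-- The weight `1 - v` turns each cosine of the expanded square into a nonnegative kernel, so
individual terms can be bounded by absolute values. -/
theorem fejer_integral_norm_expSum_sq (X : Finset ℝ) (w : ℝ → ℝ) (r : ℝ) :
    ∫ v in (0 : ℝ)..1, (1 - v) * ‖expSum X w (r * v)‖ ^ 2 =
      ∑ x ∈ X, ∑ y ∈ X, w x * w y * fejer (r * (x - y)) := by
  simp only [norm_expSum_sq, Finset.mul_sum]
  rw [intervalIntegral.integral_finsetSum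
    (fun i _ => Continuous.intervalIntegrable (by fun_prop) _ _)]
  refine Finset.sum_congr rfl fun x _ => ?_
  rw [intervalIntegral.integral_finsetSum
    (fun i _ => Continuous.intervalIntegrable (by fun_prop) _ _)]
  refine Finset.sum_congr rfl fun y _ => ?_
  rw [fejer, ← intervalIntegral.integral_const_mul]
  congr 1
  ext v
  rw [show (x - y) * (r * v) = r * (x - y) * v by ring]
  ring

/-! ### Mean squares under a Frostman condition -/

/-- `X` satisfies a Frostman condition of exponent `α` at the scales in `[1, ∞)`, relative to the
diameter `ρ`. -/
def IsFrostman (X : Finset ℝ) (D α ρ : ℝ) : Prop :=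
  ∀ y l : ℝ, 1 ≤ l →
    ((X.filter fun x => y ≤ x ∧ x ≤ y + l).card : ℝ) ≤ D * X.card * (l / ρ) ^ α

/-- Summable majorant of the Fejér kernel on unit intervals centred at the integers. -/
noncomputable def fejerMajorant (j : ℤ) : ℝ := if j = 0 then 1 else 1 / (j : ℝ) ^ 2

theorem fejerMajorant_nonneg (j : ℤ) : 0 ≤ fejerMajorant j := by
  unfold fejerMajorant; split_ifs <;> positivity

theorem summable_fejerMajorant : Summable fejerMajorant := by
  refine ((Real.summable_one_div_int_pow (p := 2)).2 (by norm_num)).congr_cofinite ?_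
  have : {(0 : ℤ)}ᶜ ∈ Filter.cofinite (α := ℤ) := (Set.finite_singleton 0).compl_mem_cofinite
  filter_upwards [this] with j hj
  simp only [Set.mem_compl_iff, Set.mem_singleton_iff] at hj
  simp [fejerMajorant, hj]

/-- For `j ≠ 0` the half-cell error is absorbed: `|u| ≥ |j| l - l / 2 ≥ 2 |j|`, and the kernel
decays like `2 / u ^ 2`. -/
theorem fejer_le_majorant {u l : ℝ} (hl : 4 ≤ l) (j : ℤ) (hj : |u - j * l| ≤ l / 2) :
    fejer u ≤ fejerMajorant j := by
  unfold fejerMajorant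
  split_ifs with h
  · linarith [fejer_le_half u]
  · have hj1 : (1 : ℝ) ≤ |(j : ℝ)| := by exact_mod_cast Int.one_le_abs h
    have h1 : |(j : ℝ)| * l ≤ |u| + l / 2 := by
      have : |(j : ℝ) * l| ≤ |u| + |u - j * l| := by
        have := abs_sub u (u - j * l)
        simpa using this
      rw [abs_mul, abs_of_pos (show 0 < l by linarith)] at this
      linarith
    have h2 : 2 * |(j : ℝ)| ≤ |u| := by nlinarith
    have hu : u ≠ 0 := by
      rintro rfl
      simp at h2
      linarith [abs_nonneg (j : ℝ), abs_pos.2 (show (j : ℝ) ≠ 0 by exact_mod_cast h)]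
    refine (fejer_le_two_div_sq hu).trans ?_
    rw [div_le_div_iff₀ (by positivity) (by positivity), ← sq_abs u, ← sq_abs (j : ℝ)]
    nlinarith [abs_nonneg u]

/-- Cut the line into cells of length `5 / R` centred at `x`. Each cell is counted by the Frostman
condition, available because `R ≤ 5` makes the length at least 1, and the kernel is summable over
cells. -/
theorem sum_fejer_le {X : Finset ℝ} {D α ρ : ℝ} (hX : IsFrostman X D α ρ) {R : ℝ} (hR : 0 < R)
    (hR5 : R ≤ 5) (x : ℝ) :
    ∑ y ∈ X, fejer (2 * R * (x - y)) ≤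
      (D * X.card * (5 / R / ρ) ^ α) * ∑' j, fejerMajorant j := by
  set l := 5 / R with hl
  have hl1 : 1 ≤ l := by rw [hl, le_div_iff₀ hR]; linarith
  have hlR : l * R = 5 := by rw [hl]; field_simp
  set q : ℝ → ℤ := fun y => round ((x - y) / l) with hq
  have hqy : ∀ y, |(x - y) - q y * l| ≤ l / 2 := by
    intro y
    have := abs_sub_round ((x - y) / l)
    have h2 : (x - y) - q y * l = ((x - y) / l - q y) * l := by
      field_simp
    rw [h2, abs_mul, abs_of_pos (show 0 < l by linarith)]
    nlinarith
  calc ∑ y ∈ X, fejer (2 * R * (x - y)) ≤ ∑ y ∈ X, fejerMajorant (q y) := by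
        refine Finset.sum_le_sum fun y _ => fejer_le_majorant (l := 2 * R * l) (by linarith) _ ?_
        have : 2 * R * (x - y) - q y * (2 * R * l) = 2 * R * ((x - y) - q y * l) := by ring
        rw [this, abs_mul, abs_of_pos (show 0 < 2 * R by linarith)]
        nlinarith [hqy y]
    _ = ∑ j ∈ X.image q, (X.filter fun y => q y = j).card • fejerMajorant j :=
        Finset.sum_comp fejerMajorant q
    _ ≤ ∑ j ∈ X.image q, (D * X.card * (l / ρ) ^ α) * fejerMajorant j := by
        refine Finset.sum_le_sum fun j _ => ?_
        rw [nsmul_eq_mul]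
        refine mul_le_mul_of_nonneg_right ?_ (fejerMajorant_nonneg j)
        refine le_trans ?_ (hX (x - j * l - l / 2) l hl1)
        gcongr with y hy
        intro h
        have := abs_le.1 (h ▸ hqy y)
        constructor <;> linarith [this.1, this.2]
    _ ≤ _ := by
        rw [← Finset.mul_sum]
        have h0 : 0 ≤ D * X.card * (l / ρ) ^ α := (Nat.cast_nonneg _).trans (hX 0 l hl1)
        exact mul_le_mul_of_nonneg_left
          (summable_fejerMajorant.sum_le_tsum _ fun j _ => fejerMajorant_nonneg j) h0

theorem integral_norm_expSum_sq_le {X : Finset ℝ} {D α ρ : ℝ} (hX : IsFrostman X D α ρ)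
    {w : ℝ → ℝ} {W : ℝ} (hw : ∀ x ∈ X, |w x| ≤ W) {R : ℝ} (hR : 0 < R) (hR5 : R ≤ 5) :
    ∫ η in (0 : ℝ)..R, ‖expSum X w η‖ ^ 2 ≤
      4 * R * (W ^ 2 * (X.card * ((D * X.card * (5 / R / ρ) ^ α) * ∑' j, fejerMajorant j))) := by
  have hc := continuous_expSum X w
  have hint : ∀ a b : ℝ, IntervalIntegrable (fun η => (1 - η / (2 * R)) * ‖expSum X w η‖ ^ 2)
      volume a b := fun a b => Continuous.intervalIntegrable (by fun_prop) _ _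
  calc ∫ η in (0 : ℝ)..R, ‖expSum X w η‖ ^ 2
      -- The Fejér weight on `[0, 2R]` is at least `1 / 2` on `[0, R]`.
      ≤ ∫ η in (0 : ℝ)..R, 2 * ((1 - η / (2 * R)) * ‖expSum X w η‖ ^ 2) := by
        refine intervalIntegral.integral_mono_on hR.le
          (Continuous.intervalIntegrable (by fun_prop) _ _) ((hint _ _).const_mul 2) ?_
        intro η hη
        have : η / (2 * R) ≤ 1 / 2 := by
          rw [div_le_div_iff₀ (by positivity) (by norm_num)]; linarith [hη.2]
        nlinarith [sq_nonneg ‖expSum X w η‖]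
    _ = 2 * ∫ η in (0 : ℝ)..R, (1 - η / (2 * R)) * ‖expSum X w η‖ ^ 2 := by
        rw [intervalIntegral.integral_const_mul]
    _ ≤ 2 * ∫ η in (0 : ℝ)..(2 * R), (1 - η / (2 * R)) * ‖expSum X w η‖ ^ 2 := by
        rw [← intervalIntegral.integral_add_adjacent_intervals (hint 0 R) (hint R (2 * R))]
        have : 0 ≤ ∫ η in R..(2 * R), (1 - η / (2 * R)) * ‖expSum X w η‖ ^ 2 := by
          refine intervalIntegral.integral_nonneg (by linarith) fun η hη => ?_
          have : η / (2 * R) ≤ 1 := by rw [div_le_one (by positivity)]; exact hη.2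
          exact mul_nonneg (by linarith) (sq_nonneg _)
        linarith
    _ = 4 * R * ∫ v in (0 : ℝ)..1, (1 - v) * ‖expSum X w (2 * R * v)‖ ^ 2 := by
        have := intervalIntegral.integral_comp_mul_left
          (a := 0) (b := 1) (c := 2 * R) (fun η => (1 - η / (2 * R)) * ‖expSum X w η‖ ^ 2)
          (by positivity)
        have h2 : ∀ v, (1 - 2 * R * v / (2 * R)) = 1 - v := fun v => by field_simp
        simp only [h2, smul_eq_mul, mul_zero, mul_one] at this
        rw [this]
        field_simp
        ring
    _ = 4 * R * ∑ x ∈ X, ∑ y ∈ X, w x * w y * fejer (2 * R * (x - y)) := by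
        rw [fejer_integral_norm_expSum_sq]
    _ ≤ 4 * R * ∑ x ∈ X, ∑ y ∈ X, W ^ 2 * fejer (2 * R * (x - y)) := by
        gcongr with x hx y hy
        · exact fejer_nonneg _
        · calc w x * w y ≤ |w x| * |w y| := by rw [← abs_mul]; exact le_abs_self _
            _ ≤ W * W := mul_le_mul (hw x hx) (hw y hy) (abs_nonneg _)
              ((abs_nonneg _).trans (hw x hx))
            _ = W ^ 2 := by ring
    _ ≤ _ := by
        simp only [← Finset.mul_sum]
        gcongr
        exact (Finset.sum_le_card_nsmul _ _ _ fun x _ => sum_fejer_le hX hR hR5 x).trans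
          (by rw [nsmul_eq_mul])

/-! ### Local averaging of exponential sums -/

theorem norm_integral_sq_le {g : ℝ → ℂ} (hg : Continuous g) {a b : ℝ} (hab : a < b) :
    ‖∫ u in a..b, g u‖ ^ 2 ≤ (b - a) * ∫ u in a..b, ‖g u‖ ^ 2 := by
  set A := ∫ u in a..b, ‖g u‖ with hA
  have h1 : ‖∫ u in a..b, g u‖ ≤ A := intervalIntegral.norm_integral_le_integral_norm hab.le
  have hba : 0 < b - a := sub_pos.2 hab
  set c := A / (b - a) with hc
  have h2 : 0 ≤ ∫ u in a..b, (‖g u‖ - c) ^ 2 :=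
    intervalIntegral.integral_nonneg hab.le fun u _ => sq_nonneg _
  have h3 : ∫ u in a..b, (‖g u‖ - c) ^ 2 =
      (∫ u in a..b, ‖g u‖ ^ 2) - 2 * c * A + (b - a) * c ^ 2 := by
    have : ∀ u, (‖g u‖ - c) ^ 2 = ‖g u‖ ^ 2 - 2 * c * ‖g u‖ + c ^ 2 := fun u => by ring
    simp only [this]
    rw [intervalIntegral.integral_add (Continuous.intervalIntegrable (by fun_prop) _ _)
      (Continuous.intervalIntegrable (by fun_prop) _ _),
      intervalIntegral.integral_sub (Continuous.intervalIntegrable (by fun_prop) _ _)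
      (Continuous.intervalIntegrable (by fun_prop) _ _),
      intervalIntegral.integral_const_mul, intervalIntegral.integral_const, smul_eq_mul]
  have hAc : A = c * (b - a) := by rw [hc]; field_simp
  have h4 : A ^ 2 ≤ (b - a) * ∫ u in a..b, ‖g u‖ ^ 2 := by
    rw [h3] at h2
    rw [hAc] at h2 ⊢
    nlinarith
  exact (pow_le_pow_left₀ (norm_nonneg _) h1 2).trans h4

/-- Weights for which averaging `expSum X (localWeight h)` over `[-h, h]` gives back the
unweighted exponential sum. -/
noncomputable def localWeight (h x : ℝ) : ℝ := (∫ u in (-h)..h, Real.cos (x * u))⁻¹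

theorem le_integral_cos {h x : ℝ} (hh : 0 < h) (hx : |x| * h ≤ 1) :
    h ≤ ∫ u in (-h)..h, Real.cos (x * u) := by
  have : ∫ u in (-h)..h, (1 / 2 : ℝ) = h := by
    rw [intervalIntegral.integral_const, smul_eq_mul]; ring
  calc h = ∫ u in (-h)..h, (1 / 2 : ℝ) := this.symm
    _ ≤ _ := by
      refine intervalIntegral.integral_mono_on (by linarith)
        (by simp) (Continuous.intervalIntegrable (by fun_prop) _ _) ?_
      intro u hu
      have h1 : |x * u| ≤ 1 := by
        rw [abs_mul]
        exact (mul_le_mul_of_nonneg_left (abs_le.2 hu) (abs_nonneg x)).trans hx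
      have h2 := Real.one_sub_sq_div_two_le_cos (x := x * u)
      have h3 : (x * u) ^ 2 ≤ 1 := by
        rw [← sq_abs]; nlinarith [abs_nonneg (x * u)]
      linarith

theorem abs_localWeight_le {h x : ℝ} (hh : 0 < h) (hx : |x| * h ≤ 1) :
    |localWeight h x| ≤ h⁻¹ := by
  have := le_integral_cos hh hx
  rw [localWeight, abs_inv, abs_of_pos (by linarith)]
  gcongr

theorem integral_exp_symm (h x : ℝ) :
    ∫ u in (-h)..h, Complex.exp ((x * u : ℝ) * Complex.I) =
      ((∫ u in (-h)..h, Real.cos (x * u) : ℝ) : ℂ) := by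
  have h1 : ∀ u : ℝ, Complex.exp ((x * u : ℝ) * Complex.I) =
      ((Real.cos (x * u) : ℝ) : ℂ) + ((Real.sin (x * u) : ℝ) : ℂ) * Complex.I := by
    intro u
    rw [Complex.exp_mul_I, Complex.ofReal_cos, Complex.ofReal_sin]
  have h2 : ∫ u in (-h)..h, Real.sin (x * u) = 0 := by
    have := intervalIntegral.integral_comp_neg (a := -h) (b := h) fun u => Real.sin (x * u)
    simp only [mul_neg, Real.sin_neg, neg_neg, intervalIntegral.integral_neg] at this
    linarith
  simp only [h1]
  rw [intervalIntegral.integral_add (Continuous.intervalIntegrable (by fun_prop) _ _)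
    (Continuous.intervalIntegrable (by fun_prop) _ _), intervalIntegral.integral_mul_const,
    intervalIntegral.integral_ofReal, intervalIntegral.integral_ofReal, h2]
  simp

theorem expSum_one_eq_integral {X : Finset ℝ} {h : ℝ} (hh : 0 < h)
    (hX : ∀ x ∈ X, |x| * h ≤ 1) (η : ℝ) :
    expSum X (fun _ => 1) η = ∫ u in (-h)..h, expSum X (localWeight h) (η + u) := by
  unfold expSum
  rw [intervalIntegral.integral_finsetSum
    (fun i _ => Continuous.intervalIntegrable (by fun_prop) _ _)]
  refine Finset.sum_congr rfl fun x hx => ?_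
  have h1 : ∀ u : ℝ, (localWeight h x : ℂ) * Complex.exp ((x * (η + u) : ℝ) * Complex.I) =
      ((localWeight h x : ℂ) * Complex.exp ((x * η : ℝ) * Complex.I)) *
        Complex.exp ((x * u : ℝ) * Complex.I) := by
    intro u
    rw [mul_assoc, ← Complex.exp_add]
    push_cast
    ring_nf
  simp only [h1]
  rw [intervalIntegral.integral_const_mul, integral_exp_symm, localWeight]
  have := le_integral_cos hh (hX x hx)
  have h0 : ((∫ u in (-h)..h, Real.cos (x * u) : ℝ) : ℂ) ≠ 0 := by
    exact_mod_cast (show (∫ u in (-h)..h, Real.cos (x * u) : ℝ) ≠ 0 by linarith)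
  rw [Complex.ofReal_inv]
  field_simp
  simp

/-- Uncertainty principle: with frequencies at most `1 / h`, a value is controlled by a mean square
at distance `h`, at the cost of changing the weights. -/
theorem norm_expSum_one_sq_le {X : Finset ℝ} {h : ℝ} (hh : 0 < h)
    (hX : ∀ x ∈ X, |x| * h ≤ 1) (η : ℝ) :
    ‖expSum X (fun _ => 1) η‖ ^ 2 ≤
      2 * h * ∫ u in (η - h)..(η + h), ‖expSum X (localWeight h) u‖ ^ 2 := by
  rw [expSum_one_eq_integral hh hX]
  have hc := continuous_expSum X (localWeight h)
  refine (norm_integral_sq_le (by fun_prop) (by linarith)).trans_eq ?_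
  rw [intervalIntegral.integral_comp_add_left (fun u => ‖expSum X (localWeight h) u‖ ^ 2) η]
  ring_nf

/-! ### Averages over dilations, shell by shell -/

/-- A finite subset of `[1, 2]` whose normalised counting measure satisfies a Frostman condition of
exponent `lam` at the scales in `[ρ⁻¹, ∞)`. -/
def IsRegularDilations (T : Finset ℝ) (E lam ρ : ℝ) : Prop :=
  (∀ t ∈ T, 1 ≤ t ∧ t ≤ 2) ∧ ∀ y l : ℝ, ρ⁻¹ ≤ l →
    ((T.filter fun t => y ≤ t ∧ t ≤ y + l).card : ℝ) ≤ E * T.card * l ^ lam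

/-- Replace each value by a mean over the window of half-width `ρ⁻¹` about `t * v`. A point `u` lies
in the windows of only those `t` in an interval of length at most `2 / (ρ * R)`, which regularity
counts. All windows lie in `[0, 5R]`. -/
theorem sum_norm_expSum_dilate_sq_le {X T : Finset ℝ} {E lam ρ : ℝ} (hρ : 1 ≤ ρ)
    (hX : ∀ x ∈ X, |x| ≤ ρ) (hT : IsRegularDilations T E lam ρ) (hlam : 0 < lam)
    {R v : ℝ} (hR : ρ⁻¹ ≤ R) (hR1 : R ≤ 1) (hv : R ≤ v) (hv2 : v ≤ 2 * R) :
    ∑ t ∈ T, ‖expSum X (fun _ => 1) (t * v)‖ ^ 2 ≤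
      2 * ρ⁻¹ * ((E * T.card * (2 / (ρ * R)) ^ lam) *
        ∫ η in (0 : ℝ)..(5 * R), ‖expSum X (localWeight ρ⁻¹) η‖ ^ 2) := by
  set h := ρ⁻¹ with hh
  have hρ0 : 0 < ρ := by linarith
  have hh0 : 0 < h := inv_pos.2 hρ0
  have hR0 : 0 < R := by linarith
  have hv0 : 0 < v := by linarith
  set G : ℝ → ℝ := fun η => ‖expSum X (localWeight h) η‖ ^ 2 with hG
  have hGc : Continuous G := by
    have hc := continuous_expSum X (localWeight h)
    fun_prop
  have hG0 : ∀ η, 0 ≤ G η := fun η => sq_nonneg _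
  have hXh : ∀ x ∈ X, |x| * h ≤ 1 := fun x hx => by
    rw [hh, mul_inv_le_iff₀ hρ0]; linarith [hX x hx]
  have hGi : IntegrableOn G (Set.Icc 0 (5 * R)) := hGc.continuousOn.integrableOn_Icc
  have hind : ∀ t ∈ T, ∫ u in (t * v - h)..(t * v + h), G u =
      ∫ u in Set.Icc 0 (5 * R), (Set.Icc (t * v - h) (t * v + h)).indicator G u := by
    intro t ht
    have ht' := hT.1 t ht
    rw [intervalIntegral.integral_of_le (by linarith), ← integral_Icc_eq_integral_Ioc,
      setIntegral_indicator measurableSet_Icc, Set.inter_eq_right.2]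
    refine Set.Icc_subset_Icc ?_ ?_ <;> nlinarith
  calc ∑ t ∈ T, ‖expSum X (fun _ => 1) (t * v)‖ ^ 2
      ≤ ∑ t ∈ T, 2 * h * ∫ u in Set.Icc 0 (5 * R),
          (Set.Icc (t * v - h) (t * v + h)).indicator G u := by
        refine Finset.sum_le_sum fun t ht => ?_
        rw [← hind t ht]
        exact norm_expSum_one_sq_le hh0 hXh _
    _ = 2 * h * ∫ u in Set.Icc 0 (5 * R),
          ∑ t ∈ T, (Set.Icc (t * v - h) (t * v + h)).indicator G u := by
        rw [← Finset.mul_sum, integral_finsetSum]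
        exact fun t _ => hGi.indicator measurableSet_Icc
    _ ≤ 2 * h * ∫ u in Set.Icc 0 (5 * R), (E * T.card * (2 / (ρ * R)) ^ lam) * G u := by
        refine mul_le_mul_of_nonneg_left ?_ (by positivity)
        refine setIntegral_mono_on
          (integrable_finsetSum _ fun t _ => hGi.indicator measurableSet_Icc)
          (hGi.const_mul _) measurableSet_Icc fun u _ => ?_
        have h1 : ∑ t ∈ T, (Set.Icc (t * v - h) (t * v + h)).indicator G u =
            (T.filter fun t => u ∈ Set.Icc (t * v - h) (t * v + h)).card * G u := by
          simp only [Set.indicator_apply]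
          rw [← Finset.sum_filter, Finset.sum_const, nsmul_eq_mul]
        rw [h1]
        refine mul_le_mul_of_nonneg_right ?_ (hG0 u)
        -- Regularity applies at this length because `v ≤ 2 * R ≤ 2`.
        have hl : ρ⁻¹ ≤ 2 * h / v := by
          rw [le_div_iff₀ hv0]; nlinarith
        have hE := hT.2 ((u - h) / v) (2 * h / v) hl
        have hE0 : 0 ≤ E * T.card := by
          have hp : 0 < (2 * h / v) ^ lam := Real.rpow_pos_of_pos (by positivity) _
          have := (Nat.cast_nonneg _).trans hE
          exact nonneg_of_mul_nonneg_left this hp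
        calc _ ≤ ((T.filter fun t => (u - h) / v ≤ t ∧ t ≤ (u - h) / v + 2 * h / v).card : ℝ) := by
              gcongr with t ht
              rintro ⟨h1, h2⟩
              rw [← add_div, div_le_iff₀ hv0, le_div_iff₀ hv0]
              constructor <;> linarith
          _ ≤ E * T.card * (2 * h / v) ^ lam := hE
          _ ≤ _ := by
              have : 2 * h / v ≤ 2 / (ρ * R) := by
                rw [hh, div_le_div_iff₀ hv0 (by positivity)]
                field_simp
                linarith
              gcongr
    _ = _ := by
        rw [integral_const_mul, integral_Icc_eq_integral_Ioc,
          intervalIntegral.integral_of_le (by linarith)]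

/-- The constant in the estimate for one dyadic shell. -/
noncomputable def shellConst (D α lam : ℝ) : ℝ :=
  640 * 2 ^ lam * 2 ^ α * (D * ∑' j, fejerMajorant j) ^ 2

/-- The sum over `t` is bounded uniformly in `v` on the shell; only the factor at `τ` is integrated.
Each factor uses the Frostman bound once, whence `2 * α` in the exponent. -/
theorem integral_shell_le {X T : Finset ℝ} {D α E lam ρ τ z : ℝ} (hρ : 1 ≤ ρ) (hD : 0 ≤ D)
    (hα : 0 ≤ α)
    (hX : ∀ x ∈ X, |x| ≤ ρ) (hXF : IsFrostman X D α ρ) (hT : IsRegularDilations T E lam ρ)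
    (hE : 0 ≤ E) (hlam : 0 < lam) (hτ : 1 ≤ τ) (hτ2 : τ ≤ 2) (hz : 1 ≤ z) (hzρ : z ≤ ρ) :
    ∫ v in (z / ρ)..(2 * z / ρ), (∑ t ∈ T, ‖expSum X (fun _ => 1) (t * v)‖ ^ 2) *
        ‖expSum X (fun _ => 1) (τ * v)‖ ^ 2 ≤
      shellConst D α lam * E * T.card * X.card ^ 4 / ρ * z ^ (2 - lam - 2 * α) := by
  have hρ0 : 0 < ρ := by linarith
  have hz0 : 0 < z := by linarith
  set R := z / ρ with hR
  have hR0 : 0 < R := by positivity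
  have hR1 : R ≤ 1 := by rw [hR, div_le_one hρ0]; exact hzρ
  have hRz : ρ * R = z := by rw [hR]; field_simp
  have hρR : ρ⁻¹ ≤ R := by rw [hR, inv_eq_one_div]; gcongr
  have h2R : 2 * z / ρ = 2 * R := by rw [hR]; ring
  rw [h2R]
  set B := ∑' j, fejerMajorant j with hB
  have hB0 : 0 ≤ B := tsum_nonneg fejerMajorant_nonneg
  set n : ℝ := (X.card : ℝ) with hn
  have hn0 : 0 ≤ n := Nat.cast_nonneg _
  set F : ℝ → ℝ := fun η => ‖expSum X (fun _ => 1) η‖ ^ 2 with hF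
  have hFc : Continuous F := by
    have hc := continuous_expSum X (fun _ => 1)
    fun_prop
  have hF0 : ∀ η, 0 ≤ F η := fun η => sq_nonneg _
  have hz1 : (2 / z) ^ lam = 2 ^ lam * z ^ (-lam) := by
    rw [Real.div_rpow (by norm_num) hz0.le, Real.rpow_neg hz0.le]; rfl
  set P := 40 * E * T.card * 2 ^ lam * (D * B) * n ^ 2 * (z * z ^ (-lam) * z ^ (-α)) with hP
  have hP0 : 0 ≤ P := by positivity
  have hΦ : ∀ v ∈ Set.Icc R (2 * R), ∑ t ∈ T, F (t * v) ≤ P := by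
    intro v hv
    refine (sum_norm_expSum_dilate_sq_le hρ hX hT hlam hρR hR1 hv.1 hv.2).trans ?_
    have h1 := integral_norm_expSum_sq_le hXF (w := localWeight ρ⁻¹) (W := ρ) (fun x hx => by
      have := abs_localWeight_le (h := ρ⁻¹) (x := x) (inv_pos.2 hρ0)
        (by rw [mul_inv_le_iff₀ hρ0]; linarith [hX x hx])
      rwa [inv_inv] at this) (R := 5 * R) (by positivity) (by linarith)
    have h2 : 5 / (5 * R) / ρ = z⁻¹ := by rw [← hRz]; field_simp
    rw [h2, Real.inv_rpow hz0.le, ← Real.rpow_neg hz0.le] at h1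
    rw [hRz, hz1]
    calc _ ≤ 2 * ρ⁻¹ * ((E * T.card * (2 ^ lam * z ^ (-lam))) *
          (4 * (5 * R) * (ρ ^ 2 * (n * ((D * n * z ^ (-α)) * B))))) := by
          gcongr
      _ = P := by
          rw [hP, ← hRz]
          field_simp
          ring
  have hI : ∫ v in R..(2 * R), F (τ * v) ≤ 16 * R * (n ^ 2 * (D * B) * (2 ^ α * z ^ (-α))) := by
    have h1 : ∫ v in R..(2 * R), F (τ * v) = τ⁻¹ * ∫ η in (τ * R)..(τ * (2 * R)), F η := by
      rw [intervalIntegral.integral_comp_mul_left F (by linarith), smul_eq_mul]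
    have h2 : ∫ η in (τ * R)..(τ * (2 * R)), F η ≤ ∫ η in (0 : ℝ)..(4 * R), F η := by
      refine intervalIntegral.integral_mono_interval (by positivity) (by nlinarith) (by nlinarith)
        (Filter.Eventually.of_forall hF0) (hFc.intervalIntegrable _ _)
    have h20 : 0 ≤ ∫ η in (τ * R)..(τ * (2 * R)), F η :=
      intervalIntegral.integral_nonneg (by nlinarith) fun η _ => hF0 η
    have h3 := integral_norm_expSum_sq_le hXF (w := fun _ => 1) (W := 1) (fun x hx => by simp)
      (R := 4 * R) (by positivity) (by linarith)
    have h4 : (5 / (4 * R) / ρ) ^ α ≤ 2 ^ α * z ^ (-α) := by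
      have : 5 / (4 * R) / ρ ≤ 2 / z := by
        rw [← hRz, div_div, div_le_div_iff₀ (by positivity) (by positivity)]
        nlinarith [mul_pos hρ0 hR0]
      calc _ ≤ (2 / z) ^ α := by gcongr
        _ = _ := by
          rw [Real.div_rpow (by norm_num) hz0.le, Real.rpow_neg hz0.le]; rfl
    rw [h1]
    calc _ ≤ 1 * ∫ η in (τ * R)..(τ * (2 * R)), F η := by
          gcongr
          exact inv_le_one_of_one_le₀ hτ
      _ ≤ 4 * (4 * R) * (1 ^ 2 * (n * ((D * n * (2 ^ α * z ^ (-α))) * B))) := by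
          rw [one_mul]
          refine (h2.trans h3).trans ?_
          gcongr
      _ = _ := by ring
  calc ∫ v in R..(2 * R), (∑ t ∈ T, F (t * v)) * F (τ * v)
      ≤ ∫ v in R..(2 * R), P * F (τ * v) := by
        refine intervalIntegral.integral_mono_on (by linarith)
          (Continuous.intervalIntegrable (by fun_prop) _ _)
          (Continuous.intervalIntegrable (by fun_prop) _ _) fun v hv => ?_
        exact mul_le_mul_of_nonneg_right (hΦ v hv) (hF0 _)
    _ = P * ∫ v in R..(2 * R), F (τ * v) := intervalIntegral.integral_const_mul _ _
    _ ≤ P * (16 * R * (n ^ 2 * (D * B) * (2 ^ α * z ^ (-α)))) := by gcongr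
    _ = _ := by
        have : z ^ (2 - lam - 2 * α) = z * z * z ^ (-lam) * z ^ (-α) * z ^ (-α) := by
          rw [show (2 - lam - 2 * α) = 1 + 1 + -lam + -α + -α by ring, Real.rpow_add hz0,
            Real.rpow_add hz0, Real.rpow_add hz0, Real.rpow_add hz0, Real.rpow_one]
        rw [this, hP, hR, shellConst]
        field_simp
        ring

/-- The constant in the collision estimate. -/
noncomputable def collisionConst (D α lam : ℝ) : ℝ :=
  8 * (1 + shellConst D α lam * (1 - (2 : ℝ) ^ (2 - lam - 2 * α))⁻¹)

theorem shellConst_nonneg (D α lam : ℝ) : 0 ≤ shellConst D α lam := by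
  unfold shellConst; positivity

/-- The trivial bound on `[0, 1 / ρ]`, plus the shells `z = 2 ^ j`, whose contributions form a
convergent geometric series. -/
theorem integral_zero_one_le {X T : Finset ℝ} {D α E lam ρ τ : ℝ} (hρ : 1 ≤ ρ) (hD : 0 ≤ D)
    (hα : 0 ≤ α)
    (hX : ∀ x ∈ X, |x| ≤ ρ) (hXF : IsFrostman X D α ρ) (hT : IsRegularDilations T E lam ρ)
    (hE : 1 ≤ E) (hlam : 0 < lam) (hτ : 1 ≤ τ) (hτ2 : τ ≤ 2) (hαl : 2 < lam + 2 * α) :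
    ∫ v in (0 : ℝ)..1, (∑ t ∈ T, ‖expSum X (fun _ => 1) (t * v)‖ ^ 2) *
        ‖expSum X (fun _ => 1) (τ * v)‖ ^ 2 ≤
      (1 + shellConst D α lam * (1 - (2 : ℝ) ^ (2 - lam - 2 * α))⁻¹) *
        (E * T.card * X.card ^ 4 / ρ) := by
  have hρ0 : 0 < ρ := by linarith
  have hc := continuous_expSum X (fun _ => 1)
  set H : ℝ → ℝ := fun v => (∑ t ∈ T, ‖expSum X (fun _ => 1) (t * v)‖ ^ 2) *
        ‖expSum X (fun _ => 1) (τ * v)‖ ^ 2 with hH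
  have hHc : Continuous H := by fun_prop
  have hH0 : ∀ v, 0 ≤ H v := fun v => by positivity
  set Y := E * T.card * X.card ^ 4 / ρ with hY
  have hY0 : 0 ≤ Y := by positivity
  set x : ℝ := (2 : ℝ) ^ (2 - lam - 2 * α) with hx
  have hx0 : 0 < x := Real.rpow_pos_of_pos (by norm_num) _
  have hx1 : x < 1 := Real.rpow_lt_one_of_one_lt_of_neg (by norm_num) (by linarith)
  set Q := shellConst D α lam
  have hQ0 : 0 ≤ Q := shellConst_nonneg D α lam
  have hfirst : ∫ v in (0 : ℝ)..(1 / ρ), H v ≤ Y := by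
    have hb : ∀ v, H v ≤ T.card * (X.card : ℝ) ^ 4 := by
      intro v
      have h1 : ∀ η, ‖expSum X (fun _ => 1) η‖ ^ 2 ≤ (X.card : ℝ) ^ 2 := fun η =>
        pow_le_pow_left₀ (norm_nonneg _) (norm_expSum_one_le X η) 2
      have h2 : ∑ t ∈ T, ‖expSum X (fun _ => 1) (t * v)‖ ^ 2 ≤ T.card * (X.card : ℝ) ^ 2 :=
        (Finset.sum_le_card_nsmul _ _ _ fun t _ => h1 _).trans_eq (nsmul_eq_mul _ _)
      calc H v ≤ (T.card * (X.card : ℝ) ^ 2) * (X.card : ℝ) ^ 2 :=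
            mul_le_mul h2 (h1 _) (by positivity) (by positivity)
        _ = _ := by ring
    calc ∫ v in (0 : ℝ)..(1 / ρ), H v ≤ ∫ v in (0 : ℝ)..(1 / ρ), T.card * (X.card : ℝ) ^ 4 :=
          intervalIntegral.integral_mono_on (by positivity) (hHc.intervalIntegrable _ _)
            (by simp) fun v _ => hb v
      _ = 1 * (T.card * (X.card : ℝ) ^ 4) / ρ := by
          rw [intervalIntegral.integral_const, smul_eq_mul]; ring
      _ ≤ E * (T.card * (X.card : ℝ) ^ 4) / ρ := by gcongr
      _ = Y := by rw [hY]; ring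
  have hind : ∀ J : ℕ, (∀ j < J, (2 : ℝ) ^ j ≤ ρ) →
      ∫ v in (0 : ℝ)..(2 ^ J / ρ), H v ≤ Y + Q * Y * ∑ j ∈ Finset.range J, x ^ j := by
    intro J
    induction J with
    | zero => intro _; simpa using hfirst
    | succ J ih =>
      intro hJ
      have h1 := ih fun j hj => hJ j (by omega)
      have h2 := integral_shell_le hρ hD hα hX hXF hT (by linarith) hlam hτ hτ2
        (one_le_pow₀ (by norm_num : (1 : ℝ) ≤ 2) (n := J)) (hJ J (by omega))
      have h3 : ((2 : ℝ) ^ J) ^ (2 - lam - 2 * α) = x ^ J := by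
        rw [hx, ← Real.rpow_natCast, ← Real.rpow_natCast, ← Real.rpow_mul (by norm_num),
          ← Real.rpow_mul (by norm_num), mul_comm]
      rw [h3] at h2
      rw [← intervalIntegral.integral_add_adjacent_intervals
        (hHc.intervalIntegrable 0 (2 ^ J / ρ)) (hHc.intervalIntegrable _ _),
        Finset.sum_range_succ, pow_succ']
      calc _ ≤ _ := add_le_add h1 h2
        _ = _ := by rw [hY]; ring
  obtain ⟨m, hm, hm'⟩ := exists_nat_pow_near hρ (by norm_num : (1 : ℝ) < 2)
  have h1 := hind (m + 1) fun j hj =>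
    (pow_le_pow_right₀ (by norm_num) (by omega : j ≤ m)).trans hm
  have h2 : ∑ j ∈ Finset.range (m + 1), x ^ j ≤ (1 - x)⁻¹ :=
    ((summable_geometric_of_lt_one hx0.le hx1).sum_le_tsum _ fun j _ => by positivity).trans_eq
      (tsum_geometric_of_lt_one hx0.le hx1)
  have h3 : ∫ v in (0 : ℝ)..1, H v ≤ ∫ v in (0 : ℝ)..(2 ^ (m + 1) / ρ), H v :=
    intervalIntegral.integral_mono_interval le_rfl (by norm_num)
      (by rw [le_div_iff₀ hρ0]; linarith) (Filter.Eventually.of_forall hH0)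
      (hHc.intervalIntegrable _ _)
  calc _ ≤ _ := h3.trans h1
    _ ≤ Y + Q * Y * (1 - x)⁻¹ := by gcongr
    _ = _ := by ring

/-! ### Counting collisions -/

theorem sum_sin_sub_mul (X : Finset ℝ) (η : ℝ) :
    ∑ a ∈ X, ∑ b ∈ X, Real.sin (η * (a - b)) = 0 := by
  have h : ∑ a ∈ X, ∑ b ∈ X, Real.sin (η * (a - b)) =
      -∑ a ∈ X, ∑ b ∈ X, Real.sin (η * (a - b)) := by
    nth_rewrite 1 [Finset.sum_comm]
    simp only [← Finset.sum_neg_distrib]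
    refine Finset.sum_congr rfl fun a _ => Finset.sum_congr rfl fun b _ => ?_
    rw [← Real.sin_neg]
    ring_nf
  linarith

/-- The quadruples `((a, b), (a', b'))` for which `t a - τ a'` and `t b - τ b'` are at most `2`
apart. -/
noncomputable def collisions (X : Finset ℝ) (t τ : ℝ) : Finset ((ℝ × ℝ) × (ℝ × ℝ)) :=
  ((X ×ˢ X) ×ˢ (X ×ˢ X)).filter fun p => |t * (p.1.1 - p.1.2) - τ * (p.2.1 - p.2.2)| ≤ 2

/-- The Fejér kernel is at least `1 / 8` on `[-2, 2]`. Its sum over all quadruples factors under the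
integral: the sine products from the addition formula cancel by antisymmetry. -/
theorem card_collisions_le (X : Finset ℝ) (t τ : ℝ) :
    ((collisions X t τ).card : ℝ) ≤
      8 * ∫ v in (0 : ℝ)..1, ‖expSum X (fun _ => 1) (t * v)‖ ^ 2 *
        ‖expSum X (fun _ => 1) (τ * v)‖ ^ 2 := by
  have hc := continuous_expSum X (fun _ => 1)
  have hkey : ∀ v : ℝ, ‖expSum X (fun _ => 1) (t * v)‖ ^ 2 *
      ‖expSum X (fun _ => 1) (τ * v)‖ ^ 2 =
      ∑ p ∈ (X ×ˢ X) ×ˢ (X ×ˢ X),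
        Real.cos ((t * (p.1.1 - p.1.2) - τ * (p.2.1 - p.2.2)) * v) := by
    intro v
    have h1 : ∀ p : (ℝ × ℝ) × (ℝ × ℝ),
        Real.cos ((t * (p.1.1 - p.1.2) - τ * (p.2.1 - p.2.2)) * v) =
        Real.cos ((p.1.1 - p.1.2) * (t * v)) * Real.cos ((p.2.1 - p.2.2) * (τ * v)) +
        Real.sin (t * v * (p.1.1 - p.1.2)) * Real.sin (τ * v * (p.2.1 - p.2.2)) := by
      intro p
      rw [show (t * (p.1.1 - p.1.2) - τ * (p.2.1 - p.2.2)) * v =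
        t * v * (p.1.1 - p.1.2) - τ * v * (p.2.1 - p.2.2) by ring, Real.cos_sub,
        mul_comm (t * v), mul_comm (τ * v)]
    simp only [h1, Finset.sum_add_distrib]
    rw [← Finset.sum_mul_sum (X ×ˢ X) (X ×ˢ X) (fun q => Real.cos ((q.1 - q.2) * (t * v)))
        (fun q => Real.cos ((q.1 - q.2) * (τ * v))) |>.trans (Finset.sum_product' _ _ _).symm,
      ← Finset.sum_mul_sum (X ×ˢ X) (X ×ˢ X) (fun q => Real.sin (t * v * (q.1 - q.2)))
        (fun q => Real.sin (τ * v * (q.1 - q.2))) |>.trans (Finset.sum_product' _ _ _).symm,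
      Finset.sum_product, Finset.sum_product, Finset.sum_product, sum_sin_sub_mul]
    simp [norm_expSum_sq]
  have h2 : ∫ v in (0 : ℝ)..1, (1 - v) * (‖expSum X (fun _ => 1) (t * v)‖ ^ 2 *
      ‖expSum X (fun _ => 1) (τ * v)‖ ^ 2) = ∑ p ∈ (X ×ˢ X) ×ˢ (X ×ˢ X),
        fejer (t * (p.1.1 - p.1.2) - τ * (p.2.1 - p.2.2)) := by
    simp only [hkey, Finset.mul_sum]
    rw [intervalIntegral.integral_finsetSum
      (fun i _ => Continuous.intervalIntegrable (by fun_prop) _ _)]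
    rfl
  have h3 : ∫ v in (0 : ℝ)..1, (1 - v) * (‖expSum X (fun _ => 1) (t * v)‖ ^ 2 *
      ‖expSum X (fun _ => 1) (τ * v)‖ ^ 2) ≤
      ∫ v in (0 : ℝ)..1, ‖expSum X (fun _ => 1) (t * v)‖ ^ 2 *
        ‖expSum X (fun _ => 1) (τ * v)‖ ^ 2 := by
    refine intervalIntegral.integral_mono_on (by norm_num)
      (Continuous.intervalIntegrable (by fun_prop) _ _)
      (Continuous.intervalIntegrable (by fun_prop) _ _) fun v hv => ?_
    exact mul_le_of_le_one_left (by positivity) (by linarith [hv.1])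
  have h4 : ((collisions X t τ).card : ℝ) * (1 / 8) ≤ ∑ p ∈ (X ×ˢ X) ×ˢ (X ×ˢ X),
        fejer (t * (p.1.1 - p.1.2) - τ * (p.2.1 - p.2.2)) := by
    rw [← nsmul_eq_mul]
    refine (Finset.card_nsmul_le_sum _ _ _ fun p hp =>
      one_eighth_le_fejer (Finset.mem_filter.1 hp).2).trans ?_
    exact Finset.sum_le_sum_of_subset_of_nonneg (Finset.filter_subset _ _)
      fun p _ _ => fejer_nonneg _
  linarith

theorem sum_card_collisions_le {X T : Finset ℝ} {D α E lam ρ τ : ℝ} (hρ : 1 ≤ ρ) (hD : 0 ≤ D)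
    (hα : 0 ≤ α)
    (hX : ∀ x ∈ X, |x| ≤ ρ) (hXF : IsFrostman X D α ρ) (hT : IsRegularDilations T E lam ρ)
    (hE : 1 ≤ E) (hlam : 0 < lam) (hτ : 1 ≤ τ) (hτ2 : τ ≤ 2) (hαl : 2 < lam + 2 * α) :
    ∑ t ∈ T, ((collisions X t τ).card : ℝ) ≤
      collisionConst D α lam * (E * T.card * X.card ^ 4 / ρ) := by
  have hc := continuous_expSum X (fun _ => 1)
  refine (Finset.sum_le_sum fun t _ => card_collisions_le X t τ).trans ?_
  rw [← Finset.mul_sum, ← intervalIntegral.integral_finsetSum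
    (fun i _ => Continuous.intervalIntegrable (by fun_prop) _ _)]
  simp only [← Finset.sum_mul]
  rw [collisionConst, mul_assoc]
  exact mul_le_mul_of_nonneg_left
    (integral_zero_one_le hρ hD hα hX hXF hT hE hlam hτ hτ2 hαl) (by norm_num)

theorem collisionConst_pos {D α lam : ℝ} (hαl : 2 < lam + 2 * α) :
    0 < collisionConst D α lam := by
  have hx1 : (2 : ℝ) ^ (2 - lam - 2 * α) < 1 :=
    Real.rpow_lt_one_of_one_lt_of_neg (by norm_num) (by linarith)
  have := mul_nonneg (shellConst_nonneg D α lam) (inv_nonneg.2 (sub_nonneg.2 hx1.le))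
  unfold collisionConst
  linarith

/-! ### Fourier coefficients of the walk -/

theorem uniformOn_singleton (S : Finset ℕ) (s : ℕ) :
    uniformOn S {s} = if s ∈ S then (S.card : ℝ≥0∞)⁻¹ else 0 := by
  simp [uniformOn, Measure.finsetSum_apply, Set.indicator_apply]

theorem actConv_uniformOn (S : Finset ℕ) (m : Measure UnitAddCircle) :
    actConv (uniformOn S) m =
      (S.card : ℝ≥0∞)⁻¹ • ∑ s ∈ S, m.map (fun x : UnitAddCircle => s • x) := by
  ext E hE
  rw [actConv, Measure.sum_apply _ hE, tsum_eq_sum (s := S)]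
  · simp only [Measure.smul_apply, Measure.finsetSum_apply, smul_eq_mul, Finset.mul_sum]
    exact Finset.sum_congr rfl fun s hs => by rw [uniformOn_singleton, if_pos hs]
  · intro s hs
    rw [uniformOn_singleton, if_neg hs]
    simp

theorem measurable_nsmul_circle (s : ℕ) : Measurable fun x : UnitAddCircle => s • x :=
  (continuous_nsmul s).measurable

theorem isProbabilityMeasure_actConv {S : Finset ℕ} (hS : S.Nonempty) (m : Measure UnitAddCircle)
    [IsProbabilityMeasure m] : IsProbabilityMeasure (actConv (uniformOn S) m) := by
  constructor
  have h : ∀ s : ℕ, m.map (fun x : UnitAddCircle => s • x) Set.univ = 1 := fun s => by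
    rw [Measure.map_apply (measurable_nsmul_circle s) MeasurableSet.univ]; simp
  rw [actConv_uniformOn]
  simp only [Measure.smul_apply, Measure.finsetSum_apply, h, smul_eq_mul, Finset.sum_const,
    nsmul_eq_mul, mul_one]
  exact ENNReal.inv_mul_cancel (by simpa using hS.ne_empty) (ENNReal.natCast_ne_top _)

theorem isProbabilityMeasure_walkMeasure {S : Finset ℕ} (hS : S.Nonempty)
    (μ : Measure UnitAddCircle) [IsProbabilityMeasure μ] (n : ℕ) :
    IsProbabilityMeasure (walkMeasure S μ n) := by
  induction n with
  | zero => simpa [walkMeasure]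
  | succ n ih =>
    have h : walkMeasure S μ (n + 1) = actConv (uniformOn S) (walkMeasure S μ n) := by
      simp only [walkMeasure, Function.iterate_succ_apply']
    rw [h]
    exact isProbabilityMeasure_actConv hS _

theorem fourier_nsmul (a : ℤ) (s : ℕ) (x : UnitAddCircle) :
    fourier a (s • x) = fourier (s * a) x := by
  rw [fourier_apply, fourier_apply, ← natCast_zsmul, smul_smul, mul_comm]

theorem measureFourierCoeff_actConv (S : Finset ℕ) (m : Measure UnitAddCircle)
    [IsProbabilityMeasure m] (a : ℤ) :
    measureFourierCoeff (actConv (uniformOn S) m) a =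
      (S.card : ℂ)⁻¹ * ∑ s ∈ S, measureFourierCoeff m (s * a) := by
  unfold measureFourierCoeff
  have hi : ∀ s ∈ S, Integrable (fun x => fourier (-a) x)
      (m.map (fun x : UnitAddCircle => s • x)) := by
    intro s _
    have := Measure.isProbabilityMeasure_map (μ := m) (measurable_nsmul_circle s).aemeasurable
    exact (map_continuous (fourier (-a))).integrable_of_hasCompactSupport
      (HasCompactSupport.of_compactSpace _)
  rw [actConv_uniformOn, integral_smul_measure, integral_finsetSum_measure hi]
  simp only [ENNReal.toReal_inv, ENNReal.toReal_natCast, Complex.real_smul, Complex.ofReal_inv,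
    Complex.ofReal_natCast]
  congr 1
  refine Finset.sum_congr rfl fun s _ => ?_
  rw [integral_map (measurable_nsmul_circle s).aemeasurable
    (map_continuous (fourier (-a))).aestronglyMeasurable]
  simp only [fourier_nsmul, mul_neg]

theorem norm_measureFourierCoeff_le_one (m : Measure UnitAddCircle) [IsProbabilityMeasure m]
    (a : ℤ) : ‖measureFourierCoeff m a‖ ≤ 1 := by
  have h := norm_integral_le_of_norm_le_const (μ := m) (f := fun x => fourier (-a) x) (C := 1)
    (Filter.Eventually.of_forall fun x => by rw [fourier_apply]; exact (Circle.norm_coe _).le)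
  rw [probReal_univ, mul_one] at h
  exact h

/-! ### From large coefficients to large coefficients at differences -/

theorem norm_integral_sq_le_integral_norm_sq {Ω : Type*} [MeasurableSpace Ω] (m : Measure Ω)
    [IsProbabilityMeasure m] {g : Ω → ℂ} (hg : Integrable g m)
    (hg2 : Integrable (fun x => ‖g x‖ ^ 2) m) :
    ‖∫ x, g x ∂m‖ ^ 2 ≤ ∫ x, ‖g x‖ ^ 2 ∂m := by
  set A := ∫ x, ‖g x‖ ∂m with hA
  have h1 : ‖∫ x, g x ∂m‖ ≤ A := norm_integral_le_integral_norm g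
  have h2 : 0 ≤ ∫ x, (‖g x‖ - A) ^ 2 ∂m := integral_nonneg fun x => sq_nonneg _
  have h3 : ∫ x, (‖g x‖ - A) ^ 2 ∂m = (∫ x, ‖g x‖ ^ 2 ∂m) - 2 * A * A + A ^ 2 := by
    have : ∀ x, (‖g x‖ - A) ^ 2 = ‖g x‖ ^ 2 - 2 * A * ‖g x‖ + A ^ 2 := fun x => by ring
    simp only [this]
    rw [integral_add (f := fun x => ‖g x‖ ^ 2 - 2 * A * ‖g x‖)
      (hg2.sub (hg.norm.const_mul _)) (integrable_const _),
      integral_sub hg2 (hg.norm.const_mul _), integral_const_mul]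
    simp [hA]
  have h4 : A ^ 2 ≤ ∫ x, ‖g x‖ ^ 2 ∂m := by nlinarith
  exact (pow_le_pow_left₀ (norm_nonneg _) h1 2).trans h4

-- The sum is the integral of a trigonometric polynomial; its squared modulus integrates to the
-- quadratic form of coefficients at differences.
open scoped ComplexConjugate in
theorem norm_sum_measureFourierCoeff_sq_le {ι : Type*} (m : Measure UnitAddCircle)
    [IsProbabilityMeasure m] (A : Finset ι) (c : ι → ℂ) (k : ι → ℤ) :
    ‖∑ i ∈ A, c i * measureFourierCoeff m (k i)‖ ^ 2 ≤
      (∑ j ∈ A, ∑ i ∈ A, conj (c j) * (c i * measureFourierCoeff m (k i - k j))).re := by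
  have hint : ∀ f : C(UnitAddCircle, ℂ), Integrable f m := fun f =>
    (map_continuous f).integrable_of_hasCompactSupport (HasCompactSupport.of_compactSpace _)
  set P : UnitAddCircle → ℂ := fun x => ∑ i ∈ A, c i * fourier (-k i) x with hP
  have hPc : Continuous P :=
    continuous_finsetSum _ fun i _ => continuous_const.mul (map_continuous _)
  have h1 : ∑ i ∈ A, c i * measureFourierCoeff m (k i) = ∫ x, P x ∂m := by
    rw [hP, integral_finsetSum _ fun i _ => (hint _).const_mul _]
    simp only [integral_const_mul, measureFourierCoeff]
  have h2 : ((∫ x, ‖P x‖ ^ 2 ∂m : ℝ) : ℂ) =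
      ∑ j ∈ A, ∑ i ∈ A, conj (c j) * (c i * measureFourierCoeff m (k i - k j)) := by
    have hx : ∀ x, ((‖P x‖ ^ 2 : ℝ) : ℂ) =
        ∑ j ∈ A, ∑ i ∈ A, conj (c j) * (c i * fourier (-(k i - k j)) x) := by
      intro x
      rw [Complex.ofReal_pow, ← Complex.conj_mul', hP]
      simp only [map_sum, map_mul, Finset.sum_mul_sum]
      refine Finset.sum_congr rfl fun j _ => Finset.sum_congr rfl fun i _ => ?_
      rw [← fourier_neg, neg_neg, show -(k i - k j) = k j + -k i by ring, fourier_add]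
      ring
    rw [← integral_complex_ofReal]
    simp only [hx]
    rw [integral_finsetSum _ fun j _ => integrable_finsetSum _ fun i _ =>
      ((hint _).const_mul _).const_mul _]
    refine Finset.sum_congr rfl fun j _ => ?_
    rw [integral_finsetSum _ fun i _ => ((hint _).const_mul _).const_mul _]
    refine Finset.sum_congr rfl fun i _ => ?_
    rw [integral_const_mul, integral_const_mul, measureFourierCoeff]
  rw [h1, ← h2, Complex.ofReal_re]
  exact norm_integral_sq_le_integral_norm_sq m (hint ⟨P, hPc⟩)
    ((hPc.norm.pow 2).integrable_of_hasCompactSupport (HasCompactSupport.of_compactSpace _))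

theorem exists_norm_one_mul_eq (z : ℂ) : ∃ c : ℂ, ‖c‖ = 1 ∧ c * z = ‖z‖ := by
  rcases eq_or_ne z 0 with rfl | hz
  · exact ⟨1, by simp, by simp⟩
  · have hz' : (‖z‖ : ℂ) ≠ 0 := by exact_mod_cast norm_ne_zero_iff.2 hz
    refine ⟨‖z‖ / z, by simp [hz], by field_simp⟩

/-- Two applications of the Cauchy–Schwarz inequality. -/
theorem exists_sum_norm_measureFourierCoeff_ge (m : Measure UnitAddCircle)
    [IsProbabilityMeasure m] {S : Finset ℕ} (hS : S.Nonempty) {B : Finset ℤ} (hB : B.Nonempty)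
    {δ : ℝ} (hδ : 0 ≤ δ)
    (h : ∀ a ∈ B, S.card * δ ≤ ‖∑ s ∈ S, measureFourierCoeff m (s * a)‖) :
    ∃ b ∈ B, ∃ t ∈ S, δ ^ 4 * (S.card * (B.card : ℝ) ^ 2) ≤
      ∑ s ∈ S, ∑ a ∈ B, ∑ a' ∈ B,
        ‖measureFourierCoeff m (s * (a - b) - t * (a' - b))‖ := by
  have hS0 : (0 : ℝ) < S.card := by exact_mod_cast hS.card_pos
  have hB0 : (0 : ℝ) < B.card := by exact_mod_cast hB.card_pos
  -- Phases aligning the sums over `s`, so that no cancellation occurs when summing over `a`.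
  choose c hc1 hc using fun a : ℤ => exists_norm_one_mul_eq (∑ s ∈ S, measureFourierCoeff m (s * a))
  set X : ℤ → ℂ := fun b => ∑ s ∈ S, ∑ a ∈ B, c a * measureFourierCoeff m (s * (a - b)) with hX
  have h1 : S.card * B.card * δ ≤ ∑ s ∈ S, ‖∑ a ∈ B, c a * measureFourierCoeff m (s * a)‖ := by
    have e : ∑ s ∈ S, ∑ a ∈ B, c a * measureFourierCoeff m (s * a) =
        ((∑ a ∈ B, ‖∑ s ∈ S, measureFourierCoeff m (s * a)‖ : ℝ) : ℂ) := by
      rw [Finset.sum_comm, Complex.ofReal_sum]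
      refine Finset.sum_congr rfl fun a _ => ?_
      rw [← hc a, Finset.mul_sum]
    calc S.card * B.card * δ = ∑ a ∈ B, S.card * δ := by
          rw [Finset.sum_const, nsmul_eq_mul]; ring
      _ ≤ ∑ a ∈ B, ‖∑ s ∈ S, measureFourierCoeff m (s * a)‖ := Finset.sum_le_sum h
      _ ≤ ‖∑ s ∈ S, ∑ a ∈ B, c a * measureFourierCoeff m (s * a)‖ := by
          rw [e, Complex.norm_real]; exact le_abs_self _
      _ ≤ _ := norm_sum_le _ _
  have h2 : (S.card * B.card * δ) ^ 2 ≤ S.card * ∑ b ∈ B, ‖X b‖ := by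
    calc (S.card * B.card * δ) ^ 2
        ≤ (∑ s ∈ S, ‖∑ a ∈ B, c a * measureFourierCoeff m (s * a)‖) ^ 2 :=
          pow_le_pow_left₀ (by positivity) h1 2
      _ ≤ S.card * ∑ s ∈ S, ‖∑ a ∈ B, c a * measureFourierCoeff m (s * a)‖ ^ 2 :=
          sq_sum_le_card_mul_sum_sq
      _ ≤ S.card * ∑ b ∈ B, ‖X b‖ := by
          gcongr
          calc _ ≤ ∑ s ∈ S, (∑ b ∈ B, ∑ a ∈ B, starRingEnd ℂ (c b) *
                (c a * measureFourierCoeff m (s * a - s * b))).re :=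
                Finset.sum_le_sum fun s _ => norm_sum_measureFourierCoeff_sq_le m B c _
            _ = (∑ b ∈ B, starRingEnd ℂ (c b) * X b).re := by
                rw [← Complex.re_sum, Finset.sum_comm]
                simp only [hX, Finset.mul_sum, mul_sub]
            _ ≤ ‖∑ b ∈ B, starRingEnd ℂ (c b) * X b‖ := Complex.re_le_norm _
            _ ≤ _ := (norm_sum_le _ _).trans (by simp [hc1])
  -- The first squaring produced differences `a - b`; pigeonhole fixes `b`.
  obtain ⟨b, hb, hXb⟩ : ∃ b ∈ B, S.card * B.card * δ ^ 2 ≤ ‖X b‖ := by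
    refine Finset.exists_le_of_sum_le hB ?_
    rw [Finset.sum_const, nsmul_eq_mul]
    refine le_of_mul_le_mul_left (le_trans (le_of_eq ?_) h2) hS0
    ring
  refine ⟨b, hb, ?_⟩
  -- The second squaring treats `X b` as one sum over `S × B`, producing differences of frequencies
  -- with two multipliers; pigeonhole then fixes `t`.
  have h3 : (S.card * B.card * δ ^ 2) ^ 2 ≤ ∑ t ∈ S, ∑ s ∈ S, ∑ a ∈ B, ∑ a' ∈ B,
        ‖measureFourierCoeff m (s * (a - b) - t * (a' - b))‖ := by
    have e : X b = ∑ p ∈ S ×ˢ B, c p.2 * measureFourierCoeff m (p.1 * (p.2 - b)) := by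
      rw [Finset.sum_product]
    calc _ ≤ ‖X b‖ ^ 2 := pow_le_pow_left₀ (by positivity) hXb 2
      _ ≤ (∑ q ∈ S ×ˢ B, ∑ p ∈ S ×ˢ B, starRingEnd ℂ (c q.2) * (c p.2 *
            measureFourierCoeff m (p.1 * (p.2 - b) - q.1 * (q.2 - b)))).re := by
          rw [e]
          exact norm_sum_measureFourierCoeff_sq_le m (S ×ˢ B) (fun p => c p.2) _
      _ ≤ ∑ q ∈ S ×ˢ B, ∑ p ∈ S ×ˢ B,
            ‖measureFourierCoeff m (p.1 * (p.2 - b) - q.1 * (q.2 - b))‖ := by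
          refine (Complex.re_le_norm _).trans ((norm_sum_le _ _).trans ?_)
          refine Finset.sum_le_sum fun q _ => (norm_sum_le _ _).trans ?_
          simp [hc1]
      _ = _ := by
          simp only [Finset.sum_product]
          refine Finset.sum_congr rfl fun t _ => ?_
          rw [Finset.sum_comm]
          exact Finset.sum_congr rfl fun s _ => Finset.sum_comm
  refine Finset.exists_le_of_sum_le hS ?_
  rw [Finset.sum_const, nsmul_eq_mul]
  exact le_trans (le_of_eq (by ring)) h3

/-! ### Separated sets, densest intervals and rescaling -/

/-- A separated subset of maximal cardinality is a net, since an uncovered point could be added. -/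
theorem exists_separated_subset (Z : Finset ℤ) {M : ℝ} (hM : 0 < M) :
    ∃ A ⊆ Z, (∀ a ∈ A, ∀ b ∈ A, a ≠ b → M ≤ |(a : ℝ) - b|) ∧
      ∀ z ∈ Z, ∃ a ∈ A, |(z : ℝ) - a| < M := by
  classical
  obtain ⟨A, hA, hmax⟩ := Finset.exists_max_image
    (Z.powerset.filter fun A : Finset ℤ => ∀ a : ℤ, a ∈ A → ∀ b : ℤ, b ∈ A → a ≠ b →
      M ≤ |(a : ℝ) - b|) Finset.card
    ⟨∅, by simp⟩
  rw [Finset.mem_filter, Finset.mem_powerset] at hA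
  refine ⟨A, hA.1, hA.2, fun z hz => ?_⟩
  by_contra! hcon
  have hzA : z ∉ A := fun h => by
    have := hcon z h
    simp at this
    linarith
  have := hmax (insert z A) (by
    rw [Finset.mem_filter, Finset.mem_powerset]
    refine ⟨Finset.insert_subset hz hA.1, ?_⟩
    intro a ha b hb hab
    rw [Finset.mem_insert] at ha hb
    rcases ha with rfl | ha <;> rcases hb with rfl | hb
    · exact absurd rfl hab
    · exact hcon b hb
    · rw [abs_sub_comm]; exact hcon a ha
    · exact hA.2 a ha b hb hab)
  rw [Finset.card_insert_of_notMem hzA] at this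
  omega

theorem card_filter_le_of_separated {A : Finset ℤ} {M : ℝ} (hM : 0 < M)
    (hA : ∀ a ∈ A, ∀ b ∈ A, a ≠ b → M ≤ |(a : ℝ) - b|) (y l : ℝ) (hl : 1 ≤ l) :
    ((A.filter fun a : ℤ => y ≤ a / M ∧ a / M ≤ y + l).card : ℝ) ≤ 2 * l := by
  have h : (A.filter fun a : ℤ => y ≤ a / M ∧ a / M ≤ y + l).card ≤
      (Finset.range (⌊l⌋₊ + 1)).card := by
    refine Finset.card_le_card_of_injOn (fun a : ℤ => ⌊(a : ℝ) / M - y⌋₊) ?_ ?_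
    · intro a ha
      rw [Finset.mem_coe, Finset.mem_filter] at ha
      rw [Finset.mem_coe, Finset.mem_range, Nat.lt_succ_iff]
      exact Nat.floor_le_floor (by linarith [ha.2.2])
    · intro a ha b hb hab
      rw [Finset.mem_coe, Finset.mem_filter] at ha hb
      by_contra hne
      have h1 := hA a ha.1 b hb.1 hne
      simp only at hab
      have ha1 := Nat.floor_le (sub_nonneg.2 ha.2.1)
      have ha2 := Nat.lt_floor_add_one ((a : ℝ) / M - y)
      have hb1 := Nat.floor_le (sub_nonneg.2 hb.2.1)
      have hb2 := Nat.lt_floor_add_one ((b : ℝ) / M - y)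
      rw [hab] at ha1 ha2
      have h2 : |(a : ℝ) / M - b / M| < 1 := abs_lt.2 ⟨by linarith, by linarith⟩
      rw [← sub_div, abs_div, abs_of_pos hM, div_lt_one hM] at h2
      linarith
  rw [Finset.card_range] at h
  have h2 : ((⌊l⌋₊ : ℕ) : ℝ) ≤ l := Nat.floor_le (by linarith)
  calc _ ≤ ((⌊l⌋₊ + 1 : ℕ) : ℝ) := by exact_mod_cast h
    _ ≤ 2 * l := by push_cast; linarith

/-- A nonempty finite set of reals of diameter at most `2K` has a nearly densest part, in the sense
of dimension `α`, in some interval of length `ρ ≥ 1`; this part is Frostman. -/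
theorem exists_frostman_interval {ι : Type*} {A : Finset ι} (hA : A.Nonempty) (x : ι → ℝ)
    {K α : ℝ} (hK : 1 ≤ K) (hα : 0 ≤ α) (hx : ∀ a ∈ A, |x a| ≤ K) :
    ∃ y ρ : ℝ, 1 ≤ ρ ∧ ρ ≤ 2 * K ∧
      (A.card : ℝ) * (ρ / (2 * K)) ^ α ≤ 2 * (A.filter fun a => y ≤ x a ∧ x a ≤ y + ρ).card ∧
      ∀ y' l : ℝ, 1 ≤ l → l ≤ ρ →
        ((A.filter fun a => y' ≤ x a ∧ x a ≤ y' + l).card : ℝ) ≤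
          2 * (A.filter fun a => y ≤ x a ∧ x a ≤ y + ρ).card * (l / ρ) ^ α := by
  set cnt : ℝ → ℝ → ℝ := fun y l => ((A.filter fun a => y ≤ x a ∧ x a ≤ y + l).card : ℝ) with hcnt
  set V : Set ℝ := {r | ∃ y l, 1 ≤ l ∧ l ≤ 2 * K ∧ r = cnt y l / l ^ α} with hV
  have hbdd : BddAbove V := by
    refine ⟨A.card, ?_⟩
    rintro r ⟨y, l, hl, -, rfl⟩
    have h1 : (1 : ℝ) ≤ l ^ α := Real.one_le_rpow hl hα
    have h2 : cnt y l ≤ A.card := by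
      simp only [hcnt]; exact_mod_cast Finset.card_filter_le _ _
    exact (div_le_self (Nat.cast_nonneg _) h1).trans h2
  have hfull : (A.card : ℝ) / (2 * K) ^ α ∈ V := by
    refine ⟨-K, 2 * K, by linarith, le_rfl, ?_⟩
    simp only [hcnt]
    rw [Finset.filter_true_of_mem]
    intro a ha
    have := abs_le.1 (hx a ha)
    constructor <;> linarith
  have hpos : 0 < sSup V := by
    have h1 : (0 : ℝ) < A.card := by exact_mod_cast hA.card_pos
    exact lt_of_lt_of_le (by positivity) (le_csSup hbdd hfull)
  -- The supremum need not be attained; settling for half of it causes the factors 2.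
  obtain ⟨r, ⟨y, ρ, hρ, hρK, rfl⟩, hr⟩ := exists_lt_of_lt_csSup ⟨_, hfull⟩ (half_lt_self hpos)
  have hρ0 : 0 < ρ := by linarith
  have hle : ∀ v ∈ V, v ≤ 2 * (cnt y ρ / ρ ^ α) := fun v hv => by
    linarith [le_csSup hbdd hv]
  have hmove : ∀ l, 0 < l → ∀ q, q / l ^ α ≤ 2 * (cnt y ρ / ρ ^ α) →
      q ≤ 2 * cnt y ρ * (l / ρ) ^ α := by
    intro l hl q hq
    rw [div_le_iff₀ (by positivity)] at hq
    rw [Real.div_rpow hl.le hρ0.le]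
    exact hq.trans_eq (by ring)
  refine ⟨y, ρ, hρ, hρK, ?_, fun y' l hl hlρ =>
    hmove l (by linarith) _ (hle _ ⟨y', l, hl, by linarith, rfl⟩)⟩
  have h1 := hmove (2 * K) (by linarith) _ (hle _ hfull)
  have hu : 0 < (ρ / (2 * K)) ^ α := by positivity
  have h2 : (2 * K / ρ) ^ α * (ρ / (2 * K)) ^ α = 1 := by
    rw [← Real.mul_rpow (by positivity) (by positivity)]
    rw [show 2 * K / ρ * (ρ / (2 * K)) = 1 by field_simp, Real.one_rpow]
  calc (A.card : ℝ) * (ρ / (2 * K)) ^ α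
      ≤ 2 * cnt y ρ * (2 * K / ρ) ^ α * (ρ / (2 * K)) ^ α := by gcongr
    _ = 2 * cnt y ρ := by rw [mul_assoc, h2, mul_one]

/-- Translation by `b` only shifts the test intervals, and lengths beyond `ρ` are trivial because
`(l / ρ) ^ α ≥ 1`. -/
theorem isFrostman_image {B : Finset ℤ} {M ρ α : ℝ} (hM : 0 < M) (hρ : 1 ≤ ρ)
    (hα : 0 ≤ α)
    (hB : ∀ y' l : ℝ, 1 ≤ l → l ≤ ρ →
      ((B.filter fun a : ℤ => y' ≤ a / M ∧ a / M ≤ y' + l).card : ℝ) ≤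
        2 * B.card * (l / ρ) ^ α) (b : ℤ) :
    IsFrostman (B.image fun a : ℤ => ((a : ℝ) - b) / M) 2 α ρ := by
  have hinj : Function.Injective fun a : ℤ => ((a : ℝ) - b) / M := by
    intro a a' h
    have : (a : ℝ) - b = a' - b := by simpa [div_left_inj' hM.ne'] using h
    exact_mod_cast sub_left_injective this
  intro y' l hl
  rw [Finset.filter_image, Finset.card_image_of_injective _ hinj,
    Finset.card_image_of_injective _ hinj]
  rcases le_total l ρ with h | h
  · refine le_trans ?_ (hB (y' + b / M) l hl h)
    refine Nat.cast_le.2 (Finset.card_le_card (Finset.monotone_filter_right _ ?_))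
    rintro a - ⟨h1, h2⟩
    rw [sub_div] at h1 h2
    constructor <;> linarith
  · have h1 : (1 : ℝ) ≤ (l / ρ) ^ α :=
      Real.one_le_rpow (by rw [le_div_iff₀ (by linarith)]; linarith) hα
    have h2 : ((B.filter fun a : ℤ => y' ≤ ((a : ℝ) - b) / M ∧ ((a : ℝ) - b) / M ≤ y' + l).card : ℝ)
        ≤ B.card := by exact_mod_cast Finset.card_filter_le _ _
    nlinarith [Nat.cast_nonneg (α := ℝ) B.card]

theorem one_le_of_isRegularSet {L C lam : ℝ} {S : Finset ℕ} (hL : 1 ≤ L) (hS : S.Nonempty)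
    (hSL : ∀ s ∈ S, L ≤ (s : ℝ) ∧ (s : ℝ) ≤ 2 * L) (hreg : IsRegularSet L S C lam) : 1 ≤ C := by
  have h := hreg L (2 * L) le_rfl (by linarith) le_rfl (by linarith)
  have h1 : (S : Set ℕ) ∩ {s | (s : ℝ) ∈ Set.Icc L (2 * L)} = S :=
    Set.inter_eq_left.2 fun s hs => hSL s hs
  rw [h1, Set.ncard_coe_finset, show (2 * L - L) / L = 1 by field_simp; ring, Real.one_rpow,
    mul_one] at h
  have h2 : (0 : ℝ) < S.card := by exact_mod_cast hS.card_pos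
  exact le_of_mul_le_mul_right (by linarith) h2

/-- A test interval of length `l < 1 / 2` is doubled and moved inside `[1, 2]`; then `l ≥ ρ⁻¹ ≥ 1 /
(2L)` gives length at least 1 before rescaling. Doubling costs `2 ^ lam' ≤ 2`. Longer intervals are
trivial since `C ≥ 1`. -/
theorem isRegularDilations_image {L C lam lam' ρ : ℝ} {S : Finset ℕ} (hL : 1 ≤ L)
    (hS : S.Nonempty) (hSL : ∀ s ∈ S, L ≤ (s : ℝ) ∧ (s : ℝ) ≤ 2 * L)
    (hreg : IsRegularSet L S C lam) (hlam : 0 < lam') (hlam' : lam' ≤ lam) (hlam1 : lam' ≤ 1)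
    (hρ : 0 < ρ) (hρL : ρ ≤ 2 * L) :
    IsRegularDilations (S.image fun s : ℕ => (s : ℝ) / L) (2 * C) lam' ρ := by
  have hL0 : 0 < L := by linarith
  have hC := one_le_of_isRegularSet hL hS hSL hreg
  have hinj : Function.Injective fun s : ℕ => (s : ℝ) / L := by
    intro a a' h
    have : (a : ℝ) = a' := by simpa [div_left_inj' hL0.ne'] using h
    exact_mod_cast this
  constructor
  · intro t ht
    obtain ⟨s, hs, rfl⟩ := Finset.mem_image.1 ht
    rw [le_div_iff₀ hL0, div_le_iff₀ hL0]
    exact ⟨by linarith [(hSL s hs).1], (hSL s hs).2⟩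
  intro y l hl
  have hl0 : 0 < l := (inv_pos.2 hρ).trans_le hl
  rw [Finset.filter_image, Finset.card_image_of_injective _ hinj,
    Finset.card_image_of_injective _ hinj]
  have h2l : (2 * l) ^ lam' ≤ 2 * l ^ lam' := by
    rw [Real.mul_rpow (by norm_num) hl0.le]
    gcongr
    calc (2 : ℝ) ^ lam' ≤ 2 ^ (1 : ℝ) := Real.rpow_le_rpow_of_exponent_le (by norm_num) hlam1
      _ = 2 := Real.rpow_one 2
  have hS0 : (0 : ℝ) ≤ S.card := Nat.cast_nonneg _
  rcases le_total (1 / 2) l with h | h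
  · have h1 : (1 : ℝ) ≤ (2 * l) ^ lam' := Real.one_le_rpow (by linarith) hlam.le
    calc _ ≤ (S.card : ℝ) := by exact_mod_cast Finset.card_filter_le _ _
      _ ≤ C * S.card * (2 * l) ^ lam' := by nlinarith [mul_nonneg (sub_nonneg.2 hC) hS0]
      _ ≤ C * S.card * (2 * l ^ lam') := by gcongr
      _ = _ := by ring
  · set z := max 1 (min y (2 - 2 * l)) with hz
    have hz1 : 1 ≤ z := le_max_left _ _
    have hz2 : z + 2 * l ≤ 2 := by
      have : z ≤ 2 - 2 * l := max_le (by linarith) (min_le_right _ _)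
      linarith
    have hlL : 1 ≤ 2 * l * L := by
      have : (2 * L)⁻¹ ≤ l := le_trans (by gcongr) hl
      rw [inv_le_iff_one_le_mul₀ (by positivity)] at this
      linarith
    have hR := hreg (L * z) (L * (z + 2 * l)) (by nlinarith) (by nlinarith) (by nlinarith)
      (by nlinarith)
    have he : (L * (z + 2 * l) - L * z) / L = 2 * l := by field_simp; ring
    rw [he] at hR
    have hcard : ((S.filter fun s : ℕ => y ≤ (s : ℝ) / L ∧ (s : ℝ) / L ≤ y + l).card : ℝ) ≤
        (((S : Set ℕ) ∩ {s | (s : ℝ) ∈ Set.Icc (L * z) (L * (z + 2 * l))}).ncard : ℝ) := by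
      rw [← Set.ncard_coe_finset]
      refine Nat.cast_le.2 (Set.ncard_le_ncard ?_ (S.finite_toSet.inter_of_left _))
      intro s hs
      rw [Finset.mem_coe, Finset.mem_filter] at hs
      obtain ⟨hs, h1, h2⟩ := hs
      obtain ⟨h3, h4⟩ := hSL s hs
      have h3' : 1 ≤ (s : ℝ) / L := by rw [le_div_iff₀ hL0]; linarith
      have h4' : (s : ℝ) / L ≤ 2 := by rw [div_le_iff₀ hL0]; linarith
      have h5 : z ≤ (s : ℝ) / L := max_le h3' ((min_le_left _ _).trans h1)
      have h6 : (s : ℝ) / L ≤ z + 2 * l := by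
        rcases le_total y (2 - 2 * l) with h | h
        · have : y ≤ z := by rw [hz, min_eq_left h]; exact le_max_right _ _
          linarith
        · have : 2 - 2 * l ≤ z := by rw [hz, min_eq_right h]; exact le_max_right _ _
          linarith
      rw [le_div_iff₀ hL0] at h5
      rw [div_le_iff₀ hL0] at h6
      exact ⟨hs, by linarith, by linarith⟩
    calc _ ≤ _ := hcard.trans hR
      _ ≤ C * (2 * l) ^ lam' * S.card := by
          have : (2 * l) ^ lam ≤ (2 * l) ^ lam' :=
            Real.rpow_le_rpow_of_exponent_ge (by positivity) (by linarith) hlam'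
          gcongr
      _ ≤ C * (2 * l ^ lam') * S.card := by gcongr
      _ = _ := by ring

/-! ### Coverings, large pairs and collisions -/

/-- Assign each point to one ball and apply Cauchy–Schwarz to the fibre sizes; two points of one
fibre are within a diameter. -/
theorem card_sq_le_card_mul_card_close {ι : Type*} (G : Finset ι) (v : ι → ℝ) (C : Finset ℝ)
    (r : ℝ) (h : ∀ p ∈ G, ∃ c ∈ C, |v p - c| < r) :
    G.card ^ 2 ≤ C.card * ((G ×ˢ G).filter fun q => |v q.1 - v q.2| ≤ 2 * r).card := by
  classical
  choose! κ hκ hκr using h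
  have h1 : G.card = ∑ c ∈ C, (G.filter fun p => κ p = c).card :=
    Finset.card_eq_sum_card_fiberwise hκ
  have h2 : ((G ×ˢ G).filter fun q => κ q.1 = κ q.2).card =
      ∑ c ∈ C, (G.filter fun p => κ p = c).card ^ 2 := by
    rw [Finset.card_eq_sum_card_fiberwise (f := fun q => κ q.1) (t := C)]
    · refine Finset.sum_congr rfl fun c _ => ?_
      rw [sq, ← Finset.card_product]
      congr 1
      ext ⟨p, q⟩
      simp only [Finset.mem_filter, Finset.mem_product]
      constructor
      · rintro ⟨⟨⟨hp, hq⟩, h1⟩, h2⟩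
        exact ⟨⟨hp, h2⟩, hq, h1 ▸ h2⟩
      · rintro ⟨⟨hp, h2⟩, hq, h3⟩
        exact ⟨⟨⟨hp, hq⟩, h2.trans h3.symm⟩, h2⟩
    · intro q hq
      rw [Finset.mem_coe, Finset.mem_filter, Finset.mem_product] at hq
      exact hκ _ hq.1.1
  calc G.card ^ 2 ≤ C.card * ∑ c ∈ C, (G.filter fun p => κ p = c).card ^ 2 := by
        rw [h1]
        exact sq_sum_le_card_mul_sum_sq
    _ ≤ _ := by
        rw [← h2]
        gcongr with q hq
        intro h
        rw [Finset.mem_product] at hq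
        have h3 := abs_lt.1 (hκr _ hq.1)
        have h4 := abs_lt.1 (hκr _ hq.2)
        rw [h] at h3
        exact abs_le.2 ⟨by linarith [h3.1, h4.2], by linarith [h3.2, h4.1]⟩

/-- Boundedness provides a finite cover, so the infimum is attained rather than being the default
value 0 of an empty set. -/
theorem exists_cover_card_eq {A : Set ℝ} {N M : ℝ} (hM : 0 < M) :
    ∃ C : Finset ℝ, C.card = ballCoveringNumber (A ∩ Set.Icc (-N) N) M ∧
      A ∩ Set.Icc (-N) N ⊆ ⋃ c ∈ C, Metric.ball c M :=
  Nat.sInf_mem (exists_ball_cover A N M hM)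

theorem ballCoveringNumber_le {A : Set ℝ} {M : ℝ} {C : Finset ℝ}
    (h : A ⊆ ⋃ c ∈ C, Metric.ball c M) : ballCoveringNumber A M ≤ C.card :=
  Nat.sInf_le ⟨C, rfl, h⟩

theorem ballCoveringNumber_pos {A : Set ℝ} {N M : ℝ} (hM : 0 < M)
    (h : (A ∩ Set.Icc (-N) N).Nonempty) : 0 < ballCoveringNumber (A ∩ Set.Icc (-N) N) M := by
  obtain ⟨C, hC, hcov⟩ := exists_cover_card_eq (A := A) (N := N) hM
  rw [← hC, Finset.card_pos]
  obtain ⟨x, hx⟩ := h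
  obtain ⟨c, hc, -⟩ := Set.mem_iUnion₂.1 (hcov hx)
  exact ⟨c, hc⟩

theorem nonempty_of_ballCoveringNumber_pos {A : Set ℝ} {M : ℝ}
    (h : 0 < ballCoveringNumber A M) : A.Nonempty := by
  by_contra hne
  rw [Set.not_nonempty_iff_eq_empty] at hne
  have := ballCoveringNumber_le (A := A) (M := M) (C := ∅) (by simp [hne])
  simp at this
  omega

/-- A large Fourier set restricted to `[-N, N]` contains an `M`-separated set of integers at least
as large as its covering number. -/
theorem exists_separated_largeFourier (m : Measure UnitAddCircle) (δ : ℝ) {N M : ℝ} (hM : 0 < M) :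
    ∃ A : Finset ℤ, (∀ a ∈ A, δ < ‖measureFourierCoeff m a‖ ∧ |(a : ℝ)| ≤ N) ∧
      (∀ a ∈ A, ∀ b ∈ A, a ≠ b → M ≤ |(a : ℝ) - b|) ∧
      ballCoveringNumber (largeFourier m δ ∩ Set.Icc (-N) N) M ≤ A.card := by
  classical
  set Z := (Finset.Icc ⌈-N⌉ ⌊N⌋).filter fun a => δ < ‖measureFourierCoeff m a‖ with hZ
  obtain ⟨A, hAZ, hsep, hcov⟩ := exists_separated_subset Z hM
  refine ⟨A, fun a ha => ?_, hsep, ?_⟩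
  · have := hAZ ha
    rw [hZ, Finset.mem_filter, Finset.mem_Icc, Int.ceil_le, Int.le_floor] at this
    exact ⟨this.2, abs_le.2 this.1⟩
  · refine (ballCoveringNumber_le (C := A.image fun a : ℤ => (a : ℝ)) ?_).trans
      Finset.card_image_le
    rintro x ⟨⟨a, -, ha, rfl⟩, hx⟩
    obtain ⟨b, hb, hab⟩ := hcov a (by
      rw [hZ, Finset.mem_filter, Finset.mem_Icc, Int.ceil_le, Int.le_floor]
      exact ⟨hx, ha⟩)
    refine Set.mem_iUnion₂.2 ⟨b, Finset.mem_image_of_mem _ hb, ?_⟩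
    rwa [Metric.mem_ball, Real.dist_eq]

/-- The pairs `p` in `B × B` for which `s (p.1 - b) - t (p.2 - b)` is a nonzero frequency with large
Fourier coefficient. -/
noncomputable def largePairs (m : Measure UnitAddCircle) (B : Finset ℤ) (b : ℤ) (t : ℕ) (θ : ℝ)
    (s : ℕ) : Finset (ℤ × ℤ) :=
  (B ×ˢ B).filter fun p => θ < ‖measureFourierCoeff m (s * (p.1 - b) - t * (p.2 - b))‖ ∧
    (s * (p.1 - b) - t * (p.2 - b) : ℤ) ≠ 0

theorem sum_norm_le_card_largePairs (m : Measure UnitAddCircle) [IsProbabilityMeasure m]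
    (B : Finset ℤ) (b : ℤ) {t : ℕ} (ht : 0 < t) {θ : ℝ} (hθ : 0 ≤ θ) (s : ℕ) :
    ∑ a ∈ B, ∑ a' ∈ B, ‖measureFourierCoeff m (s * (a - b) - t * (a' - b))‖ ≤
      (largePairs m B b t θ s).card + θ * (B.card : ℝ) ^ 2 + B.card := by
  -- Frequency zero is excluded from `largeFourier`; since `t ≠ 0`, the first entry of such a pair
  -- determines the second.
  set Z := (B ×ˢ B).filter fun p : ℤ × ℤ => (s * (p.1 - b) - t * (p.2 - b) : ℤ) = 0 with hZ
  have hZB : Z.card ≤ B.card := by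
    refine Finset.card_le_card_of_injOn Prod.fst (fun p hp => ?_) ?_
    · rw [Finset.mem_coe, hZ, Finset.mem_filter, Finset.mem_product] at hp
      exact hp.1.1
    · rintro ⟨p1, p2⟩ hp ⟨q1, q2⟩ hq h
      rw [Finset.mem_coe, hZ, Finset.mem_filter] at hp hq
      simp only at h hp hq
      subst h
      have ht' : (t : ℤ) ≠ 0 := by exact_mod_cast ht.ne'
      have : (t : ℤ) * (p2 - b) = t * (q2 - b) := by linarith [hp.2, hq.2]
      have := mul_left_cancel₀ ht' this
      rw [Prod.mk.injEq]
      exact ⟨rfl, by linarith⟩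
  rw [← Finset.sum_product']
  calc ∑ p ∈ B ×ˢ B, ‖measureFourierCoeff m (s * (p.1 - b) - t * (p.2 - b))‖
      ≤ ∑ p ∈ B ×ˢ B, ((if θ < ‖measureFourierCoeff m (s * (p.1 - b) - t * (p.2 - b))‖ ∧
          (s * (p.1 - b) - t * (p.2 - b) : ℤ) ≠ 0 then (1 : ℝ) else 0) + θ +
          (if (s * (p.1 - b) - t * (p.2 - b) : ℤ) = 0 then (1 : ℝ) else 0)) := by
        refine Finset.sum_le_sum fun p _ => ?_
        have h1 := norm_measureFourierCoeff_le_one m (s * (p.1 - b) - t * (p.2 - b))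
        by_cases h0 : (s * (p.1 - b) - t * (p.2 - b) : ℤ) = 0
        · simp only [h0, ne_eq, not_true_eq_false, and_false, if_false, if_true] at h1 ⊢
          linarith
        · by_cases h2 : θ < ‖measureFourierCoeff m (s * (p.1 - b) - t * (p.2 - b))‖
          · simp only [h0, h2, ne_eq, not_false_eq_true, and_self, if_true, if_false]
            linarith
          · simp only [h2, h0, false_and, if_false]
            linarith
    _ = (largePairs m B b t θ s).card + θ * (B.card : ℝ) ^ 2 + Z.card := by
        rw [Finset.sum_add_distrib, Finset.sum_add_distrib, Finset.sum_boole, Finset.sum_boole,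
          Finset.sum_const, Finset.card_product, nsmul_eq_mul, largePairs]
        push_cast
        ring
    _ ≤ _ := by
        have : (Z.card : ℝ) ≤ B.card := by exact_mod_cast hZB
        linarith

/-- Subtracting two frequencies in one ball cancels the terms in `b`. Regrouped by multiplier and
divided by `L * M`, the difference is exactly a collision. -/
theorem card_largePairs_sq_le {m : Measure UnitAddCircle} {B : Finset ℤ} {b : ℤ} (hb : b ∈ B)
    {s t : ℕ} {θ L M ρ : ℝ} (hL : 0 < L) (hM : 0 < M)
    (hs : (s : ℝ) ≤ 2 * L) (ht : (t : ℝ) ≤ 2 * L)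
    (hdiam : ∀ a ∈ B, ∀ a' ∈ B, |(a : ℝ) - a'| ≤ ρ * M) {C : Finset ℝ}
    (hC : largeFourier m θ ∩ Set.Icc (-(L * (4 * ρ * M))) (L * (4 * ρ * M)) ⊆
      ⋃ c ∈ C, Metric.ball c (L * M)) :
    (largePairs m B b t θ s).card ^ 2 ≤ C.card *
      (collisions (B.image fun a : ℤ => ((a : ℝ) - b) / M) (s / L) (t / L)).card := by
  set v : ℤ × ℤ → ℝ := fun p => s * ((p.1 : ℝ) - b) - t * (p.2 - b) with hv
  have hcov : ∀ p ∈ largePairs m B b t θ s, ∃ c ∈ C, |v p - c| < L * M := by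
    intro p hp
    rw [largePairs, Finset.mem_filter, Finset.mem_product] at hp
    obtain ⟨⟨hp1, hp2⟩, hθ, h0⟩ := hp
    have h1 : |v p| ≤ L * (4 * ρ * M) := by
      have e1 := hdiam _ hp1 _ hb
      have e2 := hdiam _ hp2 _ hb
      calc |v p| ≤ |(s : ℝ) * ((p.1 : ℝ) - b)| + |(t : ℝ) * ((p.2 : ℝ) - b)| := abs_sub _ _
        _ = s * |(p.1 : ℝ) - b| + t * |(p.2 : ℝ) - b| := by
            rw [abs_mul, abs_mul, Nat.abs_cast, Nat.abs_cast]
        _ ≤ 2 * L * (ρ * M) + 2 * L * (ρ * M) := by gcongr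
        _ = _ := by ring
    have h2 := hC ⟨⟨s * (p.1 - b) - t * (p.2 - b), h0, hθ, rfl⟩, by
      push_cast; exact abs_le.1 h1⟩
    obtain ⟨c, hc, h3⟩ := Set.mem_iUnion₂.1 h2
    rw [Metric.mem_ball, Real.dist_eq] at h3
    push_cast at h3
    exact ⟨c, hc, h3⟩
  refine (card_sq_le_card_mul_card_close _ v C (L * M) hcov).trans ?_
  refine Nat.mul_le_mul_left _ ?_
  set x : ℤ → ℝ := fun a => ((a : ℝ) - b) / M with hx
  have hinj : Function.Injective x := by
    intro a a' h
    have : (a : ℝ) - b = a' - b := by simpa [hx, div_left_inj' hM.ne'] using h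
    exact_mod_cast sub_left_injective this
  refine Finset.card_le_card_of_injOn
    (fun q : (ℤ × ℤ) × (ℤ × ℤ) => ((x q.1.1, x q.2.1), (x q.1.2, x q.2.2))) ?_ ?_
  · rintro ⟨⟨p1, p2⟩, ⟨q1, q2⟩⟩ hq
    rw [Finset.mem_coe, Finset.mem_filter, Finset.mem_product, largePairs, Finset.mem_filter,
      Finset.mem_filter, Finset.mem_product, Finset.mem_product] at hq
    obtain ⟨⟨⟨⟨h1, h2⟩, -⟩, ⟨⟨h3, h4⟩, -⟩⟩, h5⟩ := hq
    rw [Finset.mem_coe, collisions, Finset.mem_filter]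
    refine ⟨?_, ?_⟩
    · simp only [Finset.mem_product]
      exact ⟨⟨Finset.mem_image_of_mem _ h1, Finset.mem_image_of_mem _ h3⟩,
        Finset.mem_image_of_mem _ h2, Finset.mem_image_of_mem _ h4⟩
    · have e : (s : ℝ) / L * (x p1 - x q1) - t / L * (x p2 - x q2) =
          (v (p1, p2) - v (q1, q2)) / (L * M) := by
        simp only [hx, hv]
        field_simp
        ring
      simp only at h5 ⊢
      rw [e, abs_div, abs_of_pos (mul_pos hL hM), div_le_iff₀ (mul_pos hL hM)]
      exact h5
  · rintro ⟨⟨p1, p2⟩, ⟨q1, q2⟩⟩ - ⟨⟨p1', p2'⟩, ⟨q1', q2'⟩⟩ - h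
    simp only [Prod.mk.injEq, hinj.eq_iff] at h ⊢
    tauto

/-- The large pairs, summed over `s`, are bounded below by the double Cauchy–Schwarz argument; their
squares are bounded above by the cover size times the collisions. The powers of `S.card` and
`B.card` cancel. -/
theorem le_card_cover {L M δ Ctilde lam lam' α ρ : ℝ} {S : Finset ℕ} {m : Measure UnitAddCircle}
    [IsProbabilityMeasure m] {B : Finset ℤ} (hL : 1 ≤ L) (hM : 0 < M) (hδ : 0 < δ)
    (hS : S.Nonempty) (hSL : ∀ s ∈ S, L ≤ (s : ℝ) ∧ (s : ℝ) ≤ 2 * L)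
    (hreg : IsRegularSet L S Ctilde lam) (hlam : 0 < lam') (hlam' : lam' ≤ lam)
    (hlam1 : lam' ≤ 1) (hα : 0 ≤ α) (hαl : 2 < lam' + 2 * α) (hρ : 1 ≤ ρ) (hρL : ρ ≤ 2 * L)
    (hdiam : ∀ a ∈ B, ∀ a' ∈ B, |(a : ℝ) - a'| ≤ ρ * M)
    (hB : ∀ y' l : ℝ, 1 ≤ l → l ≤ ρ →
      ((B.filter fun a : ℤ => y' ≤ a / M ∧ a / M ≤ y' + l).card : ℝ) ≤
        2 * B.card * (l / ρ) ^ α)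
    (hlarge : ∀ a ∈ B, S.card * δ ≤ ‖∑ s ∈ S, measureFourierCoeff m (s * a)‖)
    (hBcard : 4 ≤ δ ^ 4 * B.card) {C : Finset ℝ}
    (hC : largeFourier m (δ ^ 4 / 128) ∩ Set.Icc (-(L * (4 * ρ * M))) (L * (4 * ρ * M)) ⊆
      ⋃ c ∈ C, Metric.ball c (L * M)) :
    δ ^ 8 * ρ ≤ 8 * collisionConst 2 α lam' * Ctilde * C.card := by
  have hL0 : 0 < L := by linarith
  have hρ0 : 0 < ρ := by linarith
  have hB0 : (0 : ℝ) < B.card := by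
    have : 0 < δ ^ 4 * B.card := by linarith
    exact pos_of_mul_pos_right this (by positivity)
  have hS0 : (0 : ℝ) < S.card := by exact_mod_cast hS.card_pos
  have hBne : B.Nonempty := Finset.card_pos.1 (by exact_mod_cast hB0)
  obtain ⟨b, hb, t, ht, hbt⟩ := exists_sum_norm_measureFourierCoeff_ge m hS hBne hδ.le hlarge
  have htL := hSL t ht
  have ht0 : 0 < t := by
    have : (0 : ℝ) < t := by linarith
    exact_mod_cast this
  set θ := δ ^ 4 / 128 with hθ
  set G := largePairs m B b t θ with hG
  set X := B.image fun a : ℤ => ((a : ℝ) - b) / M with hX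
  set T := S.image fun s : ℕ => (s : ℝ) / L with hT
  have hsum : δ ^ 4 / 2 * (S.card * (B.card : ℝ) ^ 2) ≤ ∑ s ∈ S, ((G s).card : ℝ) := by
    have h1 : ∑ s ∈ S, ∑ a ∈ B, ∑ a' ∈ B, ‖measureFourierCoeff m (s * (a - b) - t * (a' - b))‖ ≤
        ∑ s ∈ S, ((G s).card + (θ * (B.card : ℝ) ^ 2 + B.card)) :=
      Finset.sum_le_sum fun s _ =>
        (sum_norm_le_card_largePairs m B b ht0 (θ := θ) (by positivity) s).trans_eq
          (add_assoc _ _ _)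
    rw [Finset.sum_add_distrib, Finset.sum_const, nsmul_eq_mul] at h1
    -- `4 ≤ δ ^ 4 * B.card` makes the zero frequencies cost at most a quarter of the main term, the
    -- small coefficients `1 / 128` of it.
    have h2 : θ * (B.card : ℝ) ^ 2 + B.card ≤ δ ^ 4 / 2 * (B.card : ℝ) ^ 2 := by
      have h3 : 0 ≤ δ ^ 4 * (B.card : ℝ) ^ 2 := by positivity
      rw [hθ]
      nlinarith
    have h4 := mul_le_mul_of_nonneg_left h2 hS0.le
    linarith
  have hinjT : Function.Injective fun s : ℕ => (s : ℝ) / L := by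
    intro a a' h
    have : (a : ℝ) = a' := by simpa [div_left_inj' hL0.ne'] using h
    exact_mod_cast this
  have hinjX : Function.Injective fun a : ℤ => ((a : ℝ) - b) / M := by
    intro a a' h
    have : (a : ℝ) - b = a' - b := by simpa [div_left_inj' hM.ne'] using h
    exact_mod_cast sub_left_injective this
  have hTcard : T.card = S.card := Finset.card_image_of_injective _ hinjT
  have hXcard : X.card = B.card := Finset.card_image_of_injective _ hinjX
  have hCt := one_le_of_isRegularSet hL hS hSL hreg
  have hcoll := sum_card_collisions_le (X := X) (T := T) (D := 2) (α := α) (E := 2 * Ctilde)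
    (lam := lam') (ρ := ρ) (τ := t / L) hρ (by norm_num) hα
    (by
      intro x hx
      obtain ⟨a, ha, rfl⟩ := Finset.mem_image.1 hx
      rw [abs_div, abs_of_pos hM, div_le_iff₀ hM]
      exact hdiam a ha b hb)
    (isFrostman_image hM hρ hα hB b)
    (isRegularDilations_image hL hS hSL hreg hlam hlam' hlam1 hρ0 hρL) (by linarith) hlam
    (by rw [le_div_iff₀ hL0]; linarith) (by rw [div_le_iff₀ hL0]; linarith) hαl
  rw [hT, Finset.sum_image hinjT.injOn, ← hT, hTcard, hXcard] at hcoll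
  set Cc := collisionConst 2 α lam' with hCc
  set k : ℝ := (C.card : ℝ) with hk
  have hmain : (δ ^ 4 / 2 * (S.card * (B.card : ℝ) ^ 2)) ^ 2 ≤
      S.card * (k * (Cc * (2 * Ctilde * S.card * B.card ^ 4 / ρ))) := by
    calc _ ≤ (∑ s ∈ S, ((G s).card : ℝ)) ^ 2 := pow_le_pow_left₀ (by positivity) hsum 2
      _ ≤ S.card * ∑ s ∈ S, ((G s).card : ℝ) ^ 2 := sq_sum_le_card_mul_sum_sq
      _ ≤ S.card * ∑ s ∈ S, k * ((collisions X (s / L) (t / L)).card : ℝ) := by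
          gcongr with s hs
          have h := (Nat.cast_le (α := ℝ)).2
            (card_largePairs_sq_le hb hL0 hM (hSL s hs).2 htL.2 hdiam hC)
          rwa [Nat.cast_pow, Nat.cast_mul] at h
      _ ≤ _ := by
          rw [← Finset.mul_sum]
          gcongr
  have hpos : 0 < (S.card : ℝ) ^ 2 * (B.card : ℝ) ^ 4 / ρ := by positivity
  refine le_of_mul_le_mul_right ?_ hpos
  calc δ ^ 8 * ρ * ((S.card : ℝ) ^ 2 * (B.card : ℝ) ^ 4 / ρ)
      = 4 * (δ ^ 4 / 2 * (S.card * (B.card : ℝ) ^ 2)) ^ 2 := by field_simp; ring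
    _ ≤ 4 * (S.card * (k * (Cc * (2 * Ctilde * S.card * B.card ^ 4 / ρ)))) := by gcongr
    _ = _ := by field_simp; ring

/-! ### One step of the walk and the choice of parameters -/

theorem walkMeasure_fourierCoeff {S : Finset ℕ} (hS : S.Nonempty) (μ : Measure UnitAddCircle)
    [IsProbabilityMeasure μ] {n : ℕ} (hn : 1 ≤ n) (a : ℤ) :
    S.card * ‖measureFourierCoeff (walkMeasure S μ n) a‖ =
      ‖∑ s ∈ S, measureFourierCoeff (walkMeasure S μ (n - 1)) (s * a)‖ := by
  obtain ⟨k, rfl⟩ : ∃ k, n = k + 1 := ⟨n - 1, by omega⟩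
  have := isProbabilityMeasure_walkMeasure hS μ k
  have h : walkMeasure S μ (k + 1) = actConv (uniformOn S) (walkMeasure S μ k) := by
    simp only [walkMeasure, Function.iterate_succ_apply']
  have hS0 : (S.card : ℝ) ≠ 0 := by exact_mod_cast hS.card_pos.ne'
  rw [h, measureFourierCoeff_actConv, norm_mul, norm_inv, Complex.norm_natCast, Nat.add_sub_cancel]
  field_simp

theorem exists_mul_mem_largeFourier {S : Finset ℕ} (hS : S.Nonempty) (μ : Measure UnitAddCircle)
    [IsProbabilityMeasure μ] {n : ℕ} (hn : 1 ≤ n) {a : ℤ} {δ : ℝ}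
    (ha : δ < ‖measureFourierCoeff (walkMeasure S μ n) a‖) :
    ∃ s ∈ S, δ < ‖measureFourierCoeff (walkMeasure S μ (n - 1)) (s * a)‖ := by
  have h1 := walkMeasure_fourierCoeff hS μ hn a
  have hS0 : (0 : ℝ) < S.card := by exact_mod_cast hS.card_pos
  have h2 : ∑ s ∈ S, δ < ∑ s ∈ S, ‖measureFourierCoeff (walkMeasure S μ (n - 1)) (s * a)‖ := by
    rw [Finset.sum_const, nsmul_eq_mul]
    exact (mul_lt_mul_of_pos_left ha hS0).trans_le (h1.le.trans (norm_sum_le _ _))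
  exact Finset.exists_lt_of_sum_lt h2

/-- Exponent bookkeeping: the near-densest interval is long and its part of the set is large. -/
theorem density_exponents {K ρ κ P b : ℝ} (hκ : 0 < κ) (hκ1 : κ ≤ 1 / 4) (hρ : 1 ≤ ρ)
    (hK : (8 : ℝ) ^ (5 / κ) ≤ K) (hP : K ^ (1 - κ / 8) ≤ P)
    (hb : P * (ρ / (2 * K)) ^ (1 - κ) ≤ 2 * b) (hbρ : b ≤ 2 * ρ) :
    K ^ (2 / 3 : ℝ) ≤ ρ ∧ K ^ (1 / 2 : ℝ) ≤ 4 * b := by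
  have hρ0 : 0 < ρ := by linarith
  have hK1 : 1 ≤ K := (Real.one_le_rpow (by norm_num) (by positivity)).trans hK
  have hK0 : 0 < K := by linarith
  have h2 : (2 : ℝ) ^ (1 - κ) ≤ 2 := by
    calc (2 : ℝ) ^ (1 - κ) ≤ 2 ^ (1 : ℝ) :=
          Real.rpow_le_rpow_of_exponent_le (by norm_num) (by linarith)
      _ = 2 := Real.rpow_one 2
  have h20 : (0 : ℝ) < 2 ^ (1 - κ) := by positivity
  have hkey : K ^ (7 * κ / 8) * ρ ^ (1 - κ) ≤ 4 * b := by
    have e1 : K ^ (1 - κ / 8) = K ^ (7 * κ / 8) * K ^ (1 - κ) := by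
      rw [← Real.rpow_add hK0]; ring_nf
    have e2 : (ρ / (2 * K)) ^ (1 - κ) * (2 ^ (1 - κ) * K ^ (1 - κ)) = ρ ^ (1 - κ) := by
      rw [← Real.mul_rpow (by norm_num) hK0.le, ← Real.mul_rpow (by positivity) (by positivity)]
      congr 1
      field_simp
    have hb0 : 0 ≤ b := by
      have : 0 ≤ P * (ρ / (2 * K)) ^ (1 - κ) :=
        mul_nonneg (le_trans (by positivity) hP) (by positivity)
      linarith
    calc K ^ (7 * κ / 8) * ρ ^ (1 - κ)
        = (K ^ (1 - κ / 8) * (ρ / (2 * K)) ^ (1 - κ)) * 2 ^ (1 - κ) := by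
          rw [e1, ← e2]; ring
      _ ≤ (P * (ρ / (2 * K)) ^ (1 - κ)) * 2 ^ (1 - κ) := by gcongr
      _ ≤ (2 * b) * 2 := by gcongr
      _ = 4 * b := by ring
  have hρK : K ^ (2 / 3 : ℝ) ≤ ρ := by
    -- The lower bound `hkey` on `b` is played against the separation bound `b ≤ 2 * ρ`.
    have h1 : K ^ (7 * κ / 8) ≤ 8 * ρ ^ κ := by
      have e : ρ ^ κ * ρ ^ (1 - κ) = ρ := by
        rw [← Real.rpow_add hρ0]; simp
      have hp : 0 < ρ ^ (1 - κ) := by positivity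
      refine le_of_mul_le_mul_right ?_ hp
      rw [mul_assoc, e]
      linarith
    have h8 : (8 : ℝ) ≤ K ^ (κ / 5) := by
      calc (8 : ℝ) = ((8 : ℝ) ^ (5 / κ)) ^ (κ / 5) := by
            rw [← Real.rpow_mul (by norm_num), show 5 / κ * (κ / 5) = 1 by field_simp,
              Real.rpow_one]
        _ ≤ _ := by gcongr
    have h3 : K ^ (2 / 3 * κ) ≤ ρ ^ κ := by
      -- The constant 8 is absorbed in `K ^ (κ / 5)`, as `2 / 3 + 1 / 5 < 7 / 8`.
      have h4 : K ^ (2 / 3 * κ) * K ^ (κ / 5) ≤ K ^ (7 * κ / 8) := by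
        rw [← Real.rpow_add hK0]
        exact Real.rpow_le_rpow_of_exponent_le hK1 (by linarith)
      have h5 : 0 < K ^ (2 / 3 * κ) := by positivity
      nlinarith
    rw [Real.rpow_mul hK0.le] at h3
    exact (Real.rpow_le_rpow_iff (by positivity) hρ0.le hκ).1 h3
  refine ⟨hρK, ?_⟩
  calc K ^ (1 / 2 : ℝ) ≤ K ^ (2 / 3 * (1 - κ)) :=
        Real.rpow_le_rpow_of_exponent_le hK1 (by linarith)
    _ = (K ^ (2 / 3 : ℝ)) ^ (1 - κ) := Real.rpow_mul hK0.le _ _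
    _ ≤ ρ ^ (1 - κ) := Real.rpow_le_rpow (by positivity) hρK (by linarith)
    _ ≤ K ^ (7 * κ / 8) * ρ ^ (1 - κ) :=
        le_mul_of_one_le_left (by positivity) (Real.one_le_rpow hK1 (by positivity))
    _ ≤ _ := hkey

theorem mainTheorem4 (lam : ℝ) (hlam : 0 < lam) :
    ∃ ε₀ L₁ Cstar c : ℝ, 0 < ε₀ ∧ 0 < L₁ ∧ 0 < Cstar ∧ 0 < c ∧
      ∀ (L δ Ctilde N M : ℝ) (S : Finset ℕ) (μ : Measure UnitAddCircle) (n : ℕ),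
        L₁ < L →
        L ^ (-Cstar) < δ →
        S.Nonempty →
        (∀ s ∈ S, L ≤ (s : ℝ) ∧ (s : ℝ) ≤ 2 * L) →
        0 < Ctilde →
        IsRegularSet L S Ctilde lam →
        IsProbabilityMeasure μ →
        1 ≤ n →
        0 < M →
        0 < N →
        N ≤ L * M →
        (N / M) ^ (1 - ε₀) <
          (ballCoveringNumber
            (largeFourier (walkMeasure S μ n) δ ∩ Set.Icc (-N) N) M : ℝ) →
        ∃ N₁ : ℝ, 0 < N₁ ∧
          1 / 2 * Real.log (N / M) < Real.log (N₁ / M) ∧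
          c * δ ^ 10 / Ctilde * (N₁ / M) <
            (ballCoveringNumber
              (largeFourier (walkMeasure S μ (n - 1)) (δ ^ 4 / 128) ∩
                Set.Icc (-(L * N₁)) (L * N₁)) (L * M) : ℝ) := by
  obtain ⟨lam', hlam'0, hlam'l, hlam'1⟩ : ∃ l : ℝ, 0 < l ∧ l ≤ lam ∧ l ≤ 1 :=
    ⟨min lam 1, lt_min hlam one_pos, min_le_left _ _, min_le_right _ _⟩
  set κ := lam' / 4 with hκ
  have hκ0 : 0 < κ := by positivity
  have hκ1 : κ ≤ 1 / 4 := by linarith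
  set Cc := collisionConst 2 (1 - κ) lam' with hCc
  have hαl : 2 < lam' + 2 * (1 - κ) := by linarith
  have hCc0 : 0 < Cc := collisionConst_pos hαl
  -- The first term serves `density_exponents`; 256 yields `4 ≤ δ ^ 4 * B.card`.
  set K₀ : ℝ := (8 : ℝ) ^ (5 / κ) + 256 with hK₀
  have h80 : 0 < (8 : ℝ) ^ (5 / κ) := by positivity
  have hK₀0 : 0 < K₀ := by positivity
  refine ⟨κ / 8, 1, 1, 1 / (64 * Cc + 4 * K₀), by positivity, one_pos, one_pos, by positivity, ?_⟩
  intro L δ Ctilde N M S μ n hL hδL hS hSL hCt hreg hμ hn hM hN hNL hcov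
  have hδ : 0 < δ := (Real.rpow_pos_of_pos (by linarith) _).trans hδL
  have hCt1 : 1 ≤ Ctilde := one_le_of_isRegularSet hL.le hS hSL hreg
  have hm := isProbabilityMeasure_walkMeasure hS μ (n - 1)
  have hmn := isProbabilityMeasure_walkMeasure hS μ n
  set K := N / M with hK
  have hK0 : 0 < K := by positivity
  have hKL : K ≤ L := by rw [hK, div_le_iff₀ hM]; exact hNL
  obtain ⟨x, ⟨a₀, ha₀, hδa₀, rfl⟩, ha₀N⟩ := nonempty_of_ballCoveringNumber_pos
    (Nat.cast_pos.1 ((Real.rpow_pos_of_pos hK0 _).trans hcov))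
  have hδ1 : δ < 1 := hδa₀.trans_le (norm_measureFourierCoeff_le_one _ _)
  have hδ10 : δ ^ 10 < 1 := pow_lt_one₀ hδ.le hδ1 (by norm_num)
  -- In the first case the density to be beaten is below 1, thanks to `4 * K₀` in the denominator of
  -- `c`, so one frequency `s * a₀` is enough.
  rcases lt_or_ge (δ ^ 10 * K) K₀ with hsmall | hbig
  · have h1 : max (2 * N) M / M = max (2 * K) 1 := by
      rw [← max_div_div_right hM.le, div_self hM.ne', mul_div_assoc]
    refine ⟨max (2 * N) M, lt_max_of_lt_right hM, ?_, ?_⟩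
    · rw [h1]
      rcases lt_or_ge K 1 with h | h
      · have := Real.log_neg hK0 h
        have := Real.log_nonneg (le_max_right (2 * K) 1)
        linarith
      · have h2 := Real.log_nonneg h
        have h3 : Real.log K < Real.log (max (2 * K) 1) :=
          Real.log_lt_log hK0 (lt_max_of_lt_left (by linarith))
        linarith
    · rw [h1]
      obtain ⟨s, hs, hsa⟩ := exists_mul_mem_largeFourier hS μ hn hδa₀
      have hsL := hSL s hs
      have hpos := ballCoveringNumber_pos (A := largeFourier (walkMeasure S μ (n - 1)) (δ ^ 4 / 128))
        (N := L * max (2 * N) M) (M := L * M) (by positivity) ⟨((s * a₀ : ℤ) : ℝ), ⟨s * a₀, by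
          have : (0 : ℝ) < s := by linarith
          have : 0 < s := by exact_mod_cast this
          positivity, lt_of_le_of_lt ?_ hsa, rfl⟩, ?_⟩
      · calc _ < (1 : ℝ) := ?_
          _ ≤ _ := by exact_mod_cast hpos
        have h2 : δ ^ 10 * max (2 * K) 1 < 64 * Cc + 4 * K₀ := by
          rcases max_cases (2 * K) 1 with ⟨h, -⟩ | ⟨h, -⟩ <;> rw [h] <;> nlinarith
        rw [div_mul_eq_mul_div, one_div_mul_eq_div, div_mul_eq_mul_div, div_div,
          div_lt_one (by positivity)]
        have : 64 * Cc + 4 * K₀ ≤ (64 * Cc + 4 * K₀) * Ctilde :=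
          le_mul_of_one_le_right (by positivity) hCt1
        linarith
      · have : δ ^ 4 ≤ δ := pow_le_of_le_one hδ.le hδ1.le (by norm_num)
        linarith
      · rw [Set.mem_Icc, ← abs_le]
        push_cast
        rw [abs_mul, Nat.abs_cast]
        have h3 : |(a₀ : ℝ)| ≤ N := abs_le.2 ha₀N
        calc (s : ℝ) * |(a₀ : ℝ)| ≤ 2 * L * N := by gcongr; exact hsL.2
          _ = L * (2 * N) := by ring
          _ ≤ _ := by gcongr; exact le_max_left _ _
  · have hKδ : K₀ ≤ K := hbig.trans (mul_le_of_le_one_left hK0.le hδ10.le)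
    have hK1 : 1 ≤ K := by linarith
    obtain ⟨A, hA, hsep, hAcard⟩ :=
      exists_separated_largeFourier (walkMeasure S μ n) δ (N := N) hM
    have hP : K ^ (1 - κ / 8) ≤ A.card := hcov.le.trans (by exact_mod_cast hAcard)
    have hAne : A.Nonempty := by
      rw [← Finset.card_pos]
      exact_mod_cast (Real.rpow_pos_of_pos hK0 _).trans_le hP
    obtain ⟨y, ρ, hρ, hρK, hdense, hfro⟩ := exists_frostman_interval hAne
      (fun a : ℤ => (a : ℝ) / M) hK1 (show 0 ≤ 1 - κ by linarith) (fun a ha => by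
        rw [abs_div, abs_of_pos hM]
        exact div_le_div_of_nonneg_right (hA a ha).2 hM.le)
    set B := A.filter fun a : ℤ => y ≤ (a : ℝ) / M ∧ (a : ℝ) / M ≤ y + ρ with hB
    obtain ⟨hρbig, hBbig⟩ := density_exponents hκ0 hκ1 hρ (by linarith) hP hdense
      (card_filter_le_of_separated hM hsep y ρ hρ)
    have hρ0 : 0 < ρ := by linarith
    -- Both terms of `s (a - b) - t (a' - b)` are at most `2 * L * (ρ * M)`.
    refine ⟨4 * ρ * M, by positivity, ?_, ?_⟩
    · rw [mul_div_cancel_right₀ _ hM.ne', ← Real.log_rpow hK0]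
      refine Real.log_lt_log (by positivity) ?_
      have : K ^ (1 / 2 : ℝ) ≤ K ^ (2 / 3 : ℝ) :=
        Real.rpow_le_rpow_of_exponent_le hK1 (by norm_num)
      linarith
    · obtain ⟨C, hCcard, hC⟩ := exists_cover_card_eq
        (A := largeFourier (walkMeasure S μ (n - 1)) (δ ^ 4 / 128))
        (N := L * (4 * ρ * M)) (M := L * M) (by positivity)
      have hBcard : 4 ≤ δ ^ 4 * B.card := by
        have h1 : 16 ≤ δ ^ 4 * K ^ (1 / 2 : ℝ) := by
          have h2 : (256 : ℝ) ≤ (δ ^ 4 * K ^ (1 / 2 : ℝ)) ^ 2 := by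
            have e : (δ ^ 4 * K ^ (1 / 2 : ℝ)) ^ 2 = δ ^ 8 * K := by
              rw [mul_pow, ← Real.sqrt_eq_rpow, Real.sq_sqrt hK0.le]; ring
            have : δ ^ 10 ≤ δ ^ 8 := pow_le_pow_of_le_one hδ.le hδ1.le (by norm_num)
            rw [e]
            nlinarith
          refine (pow_le_pow_iff_left₀ (by norm_num) (by positivity) two_ne_zero).1 ?_
          linarith
        have h3 := mul_le_mul_of_nonneg_left hBbig (show 0 ≤ δ ^ 4 by positivity)
        linarith
      have hmain := le_card_cover hL.le hM hδ hS hSL hreg hlam'0 hlam'l hlam'1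
        (show 0 ≤ 1 - κ by linarith) hαl hρ (by linarith)
        (fun a ha a' ha' => by
          have h1 := (Finset.mem_filter.1 ha).2
          have h2 := (Finset.mem_filter.1 ha').2
          have h3 : |(a : ℝ) - a'| / M = |(a : ℝ) / M - a' / M| := by
            rw [← sub_div, abs_div, abs_of_pos hM]
          rw [← div_le_iff₀ hM, h3]
          exact abs_le.2 ⟨by linarith [h1.1, h2.2], by linarith [h1.2, h2.1]⟩)
        (fun y' l hl hlρ => le_trans (by
          gcongr
          exact Finset.filter_subset _ _) (hfro y' l hl hlρ))
        (fun a ha => by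
          rw [← walkMeasure_fourierCoeff hS μ hn]
          exact mul_le_mul_of_nonneg_left (hA a (Finset.mem_filter.1 ha).1).1.le
            (Nat.cast_nonneg _)) hBcard hC
      rw [← hCcard, mul_div_cancel_right₀ _ hM.ne']
      have h108 : δ ^ 10 < δ ^ 8 := pow_lt_pow_right_of_lt_one₀ hδ hδ1 (by norm_num)
      have hk : δ ^ 8 * ρ / (8 * Cc * Ctilde) ≤ C.card := by
        rw [div_le_iff₀ (by positivity)]
        linarith
      refine lt_of_lt_of_le ?_ hk
      have hD : 0 < 64 * Cc + 4 * K₀ := by positivity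
      rw [div_mul_eq_mul_div, one_div_mul_eq_div, div_mul_eq_mul_div, div_div,
        div_lt_div_iff₀ (by positivity) (by positivity)]
      calc δ ^ 10 * (4 * ρ) * (8 * Cc * Ctilde) = δ ^ 10 * (ρ * Ctilde * (32 * Cc)) := by ring
        _ < δ ^ 8 * (ρ * Ctilde * (64 * Cc + 4 * K₀)) := by
            refine mul_lt_mul'' h108 ?_ (by positivity) (by positivity)
            exact mul_lt_mul_of_pos_left (by linarith) (by positivity)
        _ = _ := by ring
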